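/- Let $M$ be the tiling of $\mathbb{R}^2$ by isosceles triangles with base $1$ and height $\tfrac12$ obtained by cutting every unit square with corners in $\mathbb{Z}^2$ into four triangles along its two diagonals. An $M$-polyform $P$ is a non-empty finite set of triangles of $M$ whose union has connected interior; we identify $P$ with this interior, an open subset of $\mathbb{R}^2$, and call $P$ convex if this open set is convex. Put $\Gamma_P=\mathbb{Z}^2\cap P$. For $f:\Gamma_P\to R$, $R\in\{\mathbb{Z},\mathbb{Q}\}$, let $\Delta_Pf(v)=\sum_{w\in\Gamma_P,\,w\sim v}f(w)-4f(v)$, where $w\sim v$ means that $v,w$ are nearest neighbours in $\mathbb{Z}^2$. The sandpile group is $G_P=\mathbb{Z}^{\Gamma_P}/\Delta_P(\mathbb{Z}^{\Gamma_P})$. For a subset $\Gamma$ of $\mathbb{Z}^2$, its boundary $\partial\Gamma$ is the set of all $v\in\Gamma$ with a neighbour in $\mathbb{Z}^2\setminus\Gamma$. We say that $H:\Gamma_P\to\mathbb{Q}$ represents $c\in G_P$ if $\Delta_PH=0$ on $\Gamma_P\setminus\partial\Gamma_P$, $\Delta_PH$ is integer-valued, and $[-\Delta_PH]=c$. Let $P_1,P_2$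 be convex $M$-polyforms. Give every side of the polygon $P_1$ a direction and a colour, different sides having different colours. A DC-tiling of $P_2$ by $P_1$ consists of finitely many tiles $g_i(P_1)$, where each $g_i$ is an isometry of $\mathbb{R}^2$ mapping $M$ to itself, such that every triangle of $P_2$ belongs to exactly one tile, all triangles of the tiles belong to $P_2$, and whenever two different tiles meet along more than a point, they do so along a common side, which has the same colour and the same direction in both. Suppose such a DC-tiling is given. Let $s_i=1$ if $g_i$ preserves orientation and $s_i=-1$ otherwise, let $\Gamma_i=\mathbb{Z}^2\cap g_i(P_1)$, and let $I=\Gamma_{P_2}\setminus\bigcup_i\Gamma_i$ be the set of internal boundary vertices. For $H:\Gamma_{P_1}\to\mathbb{Q}$ let $\hat H:\Gamma_{P_2}\to\mathbb{Q}$ be the function with $\hat H(g_i(v))=s_iH(v)$ for all $i$ and all $v\in\Gamma_{P_1}$, and $\hat H=0$ on $I$. A correction of $\hat H$ is a family of functions $X_i:\Gamma_{P_2}\to\mathbb{Z}$, one for each tile, such that for every $v\in\Gamma_{P_2}\setminus\partial\Gamma_{P_2}$ one has $\Delta_{P_2}X_i(v)=-\Delta_{P_2}\hat H(v)$ if $v\in\partial\Gamma_i$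 and $v$ has a neighbour in $I$, and $\Delta_{P_2}X_i(v)=0$ otherwise. Then there is an injective group homomorphism $\mu:G_{P_1}\to G_{P_2}$ with the following property. Every $c\in G_{P_1}$ is represented by some $H:\Gamma_{P_1}\to\mathbb{Q}$; and for every $c\in G_{P_1}$ and every $H$ that represents $c$, the function $\hat H$ has a correction, and for every correction $(X_i)_i$ the function $\hat H+\sum_iX_i$ represents $\mu(c)$. In particular, if $P_1$ DC-tiles $P_2$, then there is a group monomorphism $G_{P_1}\rightarrowtail G_{P_2}$, and $\mu$ is uniquely determined by the DC-tiling. -/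

import Mathlib

/-! ### Sandpile groups of domains of the square lattice -/

/-- The four nearest neighbours of a vertex of the square lattice. -/
def latticeNeighbors (v : ℤ × ℤ) : Finset (ℤ × ℤ) :=
  {(v.1 + 1, v.2), (v.1 - 1, v.2), (v.1, v.2 + 1), (v.1, v.2 - 1)}

/-- The boundary of a domain `Γ ⊆ ℤ²`: the vertices of `Γ` that are adjacent to the sink, i.e. that
have a neighbour outside `Γ`. -/
def domainBoundary (Γ : Set (ℤ × ℤ)) : Set (ℤ × ℤ) :=
  {v | v ∈ Γ ∧ ∃ w ∈ latticeNeighbors v, w ∉ Γ}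

open Classical in
/-- Extension of a function on `Γ` by zero to the whole lattice. -/
noncomputable def extendZero {Γ : Set (ℤ × ℤ)} {R : Type} [Ring R] (f : Γ → R) (v : ℤ × ℤ) : R :=
  if h : v ∈ Γ then f ⟨v, h⟩ else 0

/-- The reduced graph Laplacian of the domain `Γ`: adjacency minus degree in the multigraph obtained
from `ℤ²` by contracting the complement of `Γ` to the sink, with the row and the column of the sink
deleted. Every vertex of `Γ` has degree `4` in that multigraph. -/
noncomputable def reducedLaplacian (Γ : Set (ℤ × ℤ)) (R : Type) [Ring R] :
    (Γ → R) →+ (Γ → R) where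
  toFun f v := (∑ w ∈ latticeNeighbors v, extendZero f w) - 4 * f v
  map_zero' := by
    funext v
    simp [extendZero]
  map_add' f g := by
    funext v
    have h : ∀ w, extendZero (f + g) w = extendZero f w + extendZero g w := by
      intro w
      by_cases hw : w ∈ Γ <;> simp [extendZero, hw]
    simp only [h, Finset.sum_add_distrib, Pi.add_apply, mul_add]
    abel

/-- The sandpile group of the domain `Γ`: the cokernel of the reduced Laplacian on `ℤ^Γ`. -/
abbrev SandpileGroup (Γ : Set (ℤ × ℤ)) : Type :=
  (Γ → ℤ) ⧸ (reducedLaplacian Γ ℤ).range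

/-- `H` is a rational-valued function that is harmonic on `Γ` (its Laplacian vanishes off the
boundary), its Laplacian is integer-valued, and the class of `-Δ H` in the sandpile group is `c`. -/
def HarmonicRepresents {Γ : Set (ℤ × ℤ)} (H : Γ → ℚ) (c : SandpileGroup Γ) : Prop :=
  (∀ v : Γ, (v : ℤ × ℤ) ∉ domainBoundary Γ → reducedLaplacian Γ ℚ H v = 0) ∧
  ∃ X : Γ → ℤ, (∀ v, (X v : ℚ) = -reducedLaplacian Γ ℚ H v) ∧
    QuotientAddGroup.mk' (reducedLaplacian Γ ℤ).range X = c

/-! ### The triangular tiling and its polyforms -/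

/-- The Euclidean plane. -/
abbrev Plane : Type := EuclideanSpace ℝ (Fin 2)

/-- A vertex of `ℤ²` as a point of the plane. -/
noncomputable def latticePoint (v : ℤ × ℤ) : Plane := !₂[(v.1 : ℝ), (v.2 : ℝ)]

/-- The centre of the unit square with lower left corner `v`, a point of `(ℤ + 1/2)²`. -/
noncomputable def apexPoint (v : ℤ × ℤ) : Plane := !₂[(v.1 : ℝ) + 1 / 2, (v.2 : ℝ) + 1 / 2]

/-- The closed triangle with the given corners. -/
def closedTriangle (a b c : Plane) : Set Plane := convexHull ℝ {a, b, c}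

/-- The tiling `M` of the plane by isosceles triangles with base `1` and height `1/2` such that
every point of `(ℤ + 1/2)²` is the apex of four triangles: each unit square with corners in `ℤ²` is
cut into four triangles by its two diagonals. -/
def triangleTiling : Set (Set Plane) :=
  {m | ∃ i j : ℤ,
    m = closedTriangle (apexPoint (i, j)) (latticePoint (i, j)) (latticePoint (i + 1, j)) ∨
    m = closedTriangle (apexPoint (i, j)) (latticePoint (i + 1, j))
      (latticePoint (i + 1, j + 1)) ∨
    m = closedTriangle (apexPoint (i, j)) (latticePoint (i, j + 1))
      (latticePoint (i + 1, j + 1)) ∨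
    m = closedTriangle (apexPoint (i, j)) (latticePoint (i, j)) (latticePoint (i, j + 1))}

/-- The automorphisms of `M`: the isometries of the plane that map `M` to itself. -/
def IsTilingAut (g : Plane ≃ᵃⁱ[ℝ] Plane) : Prop :=
  (fun m : Set Plane => g '' m) '' triangleTiling = triangleTiling

/-- The open subset of the plane enclosed by a set of triangles. -/
def enclosedRegion (S : Set (Set Plane)) : Set Plane := interior (⋃₀ S)

/-- An `M`-polyform: a finite connected set of triangles of `M`. Connectedness (which includes
non-emptiness) is that of the enclosed open region, so that triangles are joined through common
edges and not merely through common corners. -/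
structure Polyform where
  triangles : Set (Set Plane)
  subset_tiling : triangles ⊆ triangleTiling
  finite : triangles.Finite
  connected : IsConnected (enclosedRegion triangles)

namespace Polyform

/-- The open set enclosed by the polyform. -/
def region (P : Polyform) : Set Plane := enclosedRegion P.triangles

/-- The polyform is convex. -/
def IsConvex (P : Polyform) : Prop := Convex ℝ P.region

/-- The domain `ℤ² ∩ P`. -/
def domain (P : Polyform) : Set (ℤ × ℤ) := {v | latticePoint v ∈ P.region}

/-- The edges (sides) of a convex polyform: the faces of the closed polygon that lie in its frontier
and have more than one point. -/
def IsSide (P : Polyform) (e : Set Plane) : Prop :=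
  IsExposed ℝ (closure P.region) e ∧ e ⊆ frontier P.region ∧ e.Nontrivial

end Polyform

/-- An assignment of colours and directions to the sides of a polyform, such that different sides
have different colours. The side `e` is directed from `tail e` to `head e`. -/
structure DCStructure (P : Polyform) where
  color : Set Plane → ℕ
  color_injOn : Set.InjOn color {e | P.IsSide e}
  tail : Set Plane → Plane
  head : Set Plane → Plane
  segment_eq : ∀ e, P.IsSide e → segment ℝ (tail e) (head e) = e

/-- A DC-tiling of `P₂` by copies of `P₁` (with coloured and directed sides): the copies are images
of `P₁` under automorphisms of `M`, every triangle of `P₂` belongs to exactly one copy, and whenever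
two different copies meet along more than a point, they do so along a common side, which has the
same colour and the same direction in both. -/
structure DCTiling {P₁ : Polyform} (D : DCStructure P₁) (P₂ : Polyform) where
  /-- the number of tiles -/
  n : ℕ
  /-- the transformation that carries `P₁` to the tile -/
  place : Fin n → (Plane ≃ᵃⁱ[ℝ] Plane)
  isTilingAut : ∀ i, IsTilingAut (place i)
  cover : (⋃ i, (fun m : Set Plane => place i '' m) '' P₁.triangles) = P₂.triangles
  disjoint : ∀ i j, i ≠ j → Disjoint ((fun m : Set Plane => place i '' m) '' P₁.triangles)
    ((fun m : Set Plane => place j '' m) '' P₁.triangles)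
  matching : ∀ i j, i ≠ j → ∀ e e', P₁.IsSide e → P₁.IsSide e' →
    (place i '' e ∩ place j '' e').Nontrivial →
      place i '' e = place j '' e' ∧ D.color e = D.color e' ∧
      place i (D.tail e) = place j (D.tail e') ∧ place i (D.head e) = place j (D.head e')

namespace DCTiling

variable {P₁ P₂ : Polyform} {D : DCStructure P₁}

/-- The domain `Γ_i = ℤ² ∩ P_i` of the `i`-th tile. -/
def tileDomain (T : DCTiling D P₂) (i : Fin T.n) : Set (ℤ × ℤ) :=
  {v | latticePoint v ∈ T.place i '' P₁.region}

/-- The internal boundaries of the tiling: the vertices of `ℤ² ∩ P₂` that belong to no tile. -/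
def internalBoundary (T : DCTiling D P₂) : Set (ℤ × ℤ) :=
  P₂.domain \ ⋃ i, T.tileDomain i

open Classical in
/-- The sign of a tile: `1` if it is obtained from `P₁` by translations and rotations only, and `-1`
otherwise. -/
noncomputable def sign (T : DCTiling D P₂) (i : Fin T.n) : ℚ :=
  if LinearMap.det ((T.place i).linearIsometryEquiv.toLinearEquiv : Plane →ₗ[ℝ] Plane) = 1
  then 1 else -1

open Classical in
/-- The reflected extension of a function `H` on `ℤ² ∩ P₁`: on the `i`-th tile it is the transported
function times the sign of the tile, and it vanishes on the internal boundaries. Since the tiles do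
not overlap, at most one summand is not zero. -/
noncomputable def reflect (T : DCTiling D P₂) (H : P₁.domain → ℚ) (w : P₂.domain) : ℚ :=
  ∑ i, if h : ∃ v : P₁.domain, T.place i (latticePoint v) = latticePoint w
    then T.sign i * H h.choose else 0

/-- The integer-valued functions `X i` correct the reflected extension of `H`, one tile at a time:
in the interior of `ℤ² ∩ P₂`, the Laplacian of `X i` is the negative of that of the reflected
extension at the boundary vertices of the `i`-th tile that are adjacent to an internal boundary, and
it vanishes at all other vertices. -/
def IsCorrection (T : DCTiling D P₂) (H : P₁.domain → ℚ)
    (X : Fin T.n → P₂.domain → ℤ) : Prop :=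
  ∀ i, ∀ v : P₂.domain, (v : ℤ × ℤ) ∉ domainBoundary P₂.domain →
    ((((v : ℤ × ℤ) ∈ domainBoundary (T.tileDomain i) ∧
        ∃ b ∈ latticeNeighbors v, b ∈ T.internalBoundary) →
      (reducedLaplacian P₂.domain ℤ (X i) v : ℚ) =
        -reducedLaplacian P₂.domain ℚ (T.reflect H) v) ∧
    (¬((v : ℤ × ℤ) ∈ domainBoundary (T.tileDomain i) ∧
        ∃ b ∈ latticeNeighbors v, b ∈ T.internalBoundary) →
      reducedLaplacian P₂.domain ℤ (X i) v = 0))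

/-- The reflected extension of `H` plus all corrections. -/
noncomputable def corrected (T : DCTiling D P₂) (H : P₁.domain → ℚ)
    (X : Fin T.n → P₂.domain → ℤ) (v : P₂.domain) : ℚ :=
  T.reflect H v + ∑ i, (X i v : ℚ)

end DCTiling

/-! A class in the sandpile group is encoded by a rational function, and it is trivial exactly when
this function is integer-valued (`HarmonicRepresents.eq_zero_iff`). This rests on the injectivity of
the rational Laplacian, a consequence of the maximum principle. Representing functions exist because
the Poisson equation can be solved over ℤ at all non-boundary vertices, column by column
(`exists_reducedLaplacian_eq_of_notMem_boundary`).

On each tile the reflected extension has the transported Laplacian up to sign. The crux is that its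
Laplacian vanishes at internal boundary vertices
(`reducedLaplacian_reflect_of_mem_internalBoundary`). Tiles that meet along a segment share the
image of one and the same side of `P₁`, pointwise, so they are mirror images in that segment with
opposite signs (`exists_reflection_of_adjacent`). Around an internal vertex the eight triangles of
`M` are distributed among tiles. No convex tile contains two opposite ones, and the reflections pair
off the neighbouring values so that they cancel (`sum_eq_zero_of_reflections`).

Hence the extension has an integral Laplacian, which off the boundary of the large domain is
non-zero only at tile boundary vertices next to an internal boundary. Integer-valued corrections
remove these defects, so the corrected function represents a class. Integer-valued terms do not
affect integrality, and the extension is integral iff the original function is. So the new class is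
trivial iff the old one is (`eq_zero_iff_of_corrected`). Applied to differences this gives
independence of all choices, and with it additivity; applied to a single class it gives injectivity.
-/

/-! ### The Laplacian of a finite domain: uniqueness and solvability. -/

lemma sum_latticeNeighbors {R : Type*} [AddCommMonoid R] (F : ℤ × ℤ → R) (v : ℤ × ℤ) :
    ∑ w ∈ latticeNeighbors v, F w =
      F (v.1 + 1, v.2) + (F (v.1 - 1, v.2) + (F (v.1, v.2 + 1) + F (v.1, v.2 - 1))) := by
  unfold latticeNeighbors
  rw [Finset.sum_insert, Finset.sum_insert, Finset.sum_insert, Finset.sum_singleton]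
  all_goals simp
  all_goals omega

lemma reducedLaplacian_apply {Γ : Set (ℤ × ℤ)} {R : Type} [Ring R] (f : Γ → R) (v : Γ) :
    reducedLaplacian Γ R f v =
      (∑ w ∈ latticeNeighbors (v : ℤ × ℤ), extendZero f w) - 4 * f v := rfl

lemma extendZero_of_mem {Γ : Set (ℤ × ℤ)} {R : Type} [Ring R] (f : Γ → R) {v : ℤ × ℤ}
    (h : v ∈ Γ) : extendZero f v = f ⟨v, h⟩ := by
  simp [extendZero, h]

lemma extendZero_of_notMem {Γ : Set (ℤ × ℤ)} {R : Type} [Ring R] (f : Γ → R) {v : ℤ × ℤ}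
    (h : v ∉ Γ) : extendZero f v = 0 := by
  simp [extendZero, h]

lemma extendZero_coe {Γ : Set (ℤ × ℤ)} {R : Type} [Ring R] (f : Γ → R) (v : Γ) :
    extendZero f v = f v :=
  extendZero_of_mem f v.2

lemma extendZero_intCast {Γ : Set (ℤ × ℤ)} (f : Γ → ℤ) (v : ℤ × ℤ) :
    extendZero (fun w => (f w : ℚ)) v = (extendZero f v : ℤ) := by
  by_cases h : v ∈ Γ <;> simp [extendZero, h]

lemma reducedLaplacian_intCast {Γ : Set (ℤ × ℤ)} (f : Γ → ℤ) (v : Γ) :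
    reducedLaplacian Γ ℚ (fun w => (f w : ℚ)) v = (reducedLaplacian Γ ℤ f v : ℤ) := by
  simp [reducedLaplacian_apply, extendZero_intCast]

/-- The maximum principle. -/
lemma nonpos_of_reducedLaplacian_eq_zero {Γ : Set (ℤ × ℤ)} [Finite Γ] {f : Γ → ℚ}
    (hf : reducedLaplacian Γ ℚ f = 0) (v : Γ) : f v ≤ 0 := by
  have : Nonempty Γ := ⟨v⟩
  -- Ties are broken by the first coordinate: `m` is a rightmost maximum. At a positive maximum,
  -- averaging forces the right neighbour to be a maximum too, which is impossible both inside and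
  -- outside `Γ`.
  obtain ⟨m, hm⟩ := Finite.exists_max (fun w : Γ => toLex (f w, (w : ℤ × ℤ).1))
  have hle : ∀ w, f w ≤ f m := fun w => by
    rcases Prod.Lex.le_iff.1 (hm w) with h | h
    · exact h.le
    · exact h.1.le
  refine (hle v).trans ?_
  by_contra! hpos
  have hext : ∀ w, extendZero f w ≤ f m := fun w => by
    by_cases hw : w ∈ Γ
    · rw [extendZero_of_mem f hw]; exact hle _
    · rw [extendZero_of_notMem f hw]; exact hpos.le
  have h0 : reducedLaplacian Γ ℚ f m = 0 := by rw [hf]; rfl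
  rw [reducedLaplacian_apply, sum_latticeNeighbors] at h0
  have h1 := hext ((m : ℤ × ℤ).1 - 1, (m : ℤ × ℤ).2)
  have h2 := hext ((m : ℤ × ℤ).1, (m : ℤ × ℤ).2 + 1)
  have h3 := hext ((m : ℤ × ℤ).1, (m : ℤ × ℤ).2 - 1)
  have h4 : f m ≤ extendZero f ((m : ℤ × ℤ).1 + 1, (m : ℤ × ℤ).2) := by linarith
  by_cases hw : ((m : ℤ × ℤ).1 + 1, (m : ℤ × ℤ).2) ∈ Γ
  · rw [extendZero_of_mem f hw] at h4
    rcases Prod.Lex.le_iff.1 (hm ⟨_, hw⟩) with h | h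
    · exact absurd h (not_lt.2 h4)
    · have := h.2
      simp at this
  · rw [extendZero_of_notMem f hw] at h4
    linarith

lemma reducedLaplacian_injective (Γ : Set (ℤ × ℤ)) [Finite Γ] :
    Function.Injective (reducedLaplacian Γ ℚ) := by
  refine (injective_iff_map_eq_zero _).2 fun f hf => ?_
  funext v
  refine le_antisymm (nonpos_of_reducedLaplacian_eq_zero hf v) ?_
  have h := nonpos_of_reducedLaplacian_eq_zero (f := -f) (by rw [map_neg, hf, neg_zero]) v
  simpa using h

lemma reducedLaplacian_surjective (Γ : Set (ℤ × ℤ)) [Finite Γ] :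
    Function.Surjective (reducedLaplacian Γ ℚ) :=
  (LinearMap.injective_iff_surjective (f := (reducedLaplacian Γ ℚ).toRatLinearMap)).1
    (reducedLaplacian_injective Γ)

/-- Two consecutive columns of a solution of the discrete Poisson equation on the lattice. -/
def poissonColumns (f : ℕ → ℤ → ℤ) : ℕ → (ℤ → ℤ) × (ℤ → ℤ)
  | 0 => (0, 0)
  | n + 1 => ((poissonColumns f n).2, fun y =>
      f n y + 4 * (poissonColumns f n).2 y - (poissonColumns f n).1 y
        - (poissonColumns f n).2 (y + 1) - (poissonColumns f n).2 (y - 1))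

/-- The right neighbour enters the Laplacian with coefficient 1, so the equation at one column
determines the next column without division. Starting from zero columns, this solves the equation
over ℤ wherever all four neighbours lie in `Γ`. -/
lemma exists_reducedLaplacian_eq_of_notMem_boundary (Γ : Set (ℤ × ℤ)) [Finite Γ] (f : Γ → ℤ) :
    ∃ g : Γ → ℤ, ∀ v : Γ, (v : ℤ × ℤ) ∉ domainBoundary Γ → reducedLaplacian Γ ℤ g v = f v := by
  obtain ⟨x₀, hx₀⟩ : ∃ x₀ : ℤ, ∀ v : Γ, x₀ ≤ (v : ℤ × ℤ).1 := by
    obtain ⟨x₀, h⟩ := (Set.finite_range (fun v : Γ => (v : ℤ × ℤ).1)).bddBelow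
    exact ⟨x₀, fun v => h ⟨v, rfl⟩⟩
  set c := poissonColumns (fun n y => extendZero f (x₀ + n, y)) with hc
  let G : ℤ × ℤ → ℤ := fun v => (c (v.1 - x₀).toNat).2 v.2
  refine ⟨fun v => G v, fun v hv => ?_⟩
  have hmem : ∀ w ∈ latticeNeighbors (v : ℤ × ℤ), w ∈ Γ := by
    intro w hw
    by_contra h
    exact hv ⟨v.2, w, hw, h⟩
  rw [reducedLaplacian_apply,
    Finset.sum_congr rfl fun w hw => extendZero_of_mem (fun v : Γ => G v) (hmem w hw),
    sum_latticeNeighbors]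
  obtain ⟨⟨x, y⟩, hxy⟩ := v
  -- The left neighbour lies in `Γ` too, so the abscissa is at least `x₀ + 1` and `toNat` never
  -- truncates.
  have hm1 := hx₀ ⟨(x - 1, y), hmem _ (by simp [latticeNeighbors])⟩
  obtain ⟨n, rfl⟩ : ∃ n : ℕ, x = x₀ + (n + 1 : ℕ) := ⟨(x - 1 - x₀).toNat, by simp at hm1 ⊢; omega⟩
  have e1 : (x₀ + ((n + 1 : ℕ) : ℤ) + 1 - x₀).toNat = n + 1 + 1 := by omega
  have e2 : (x₀ + ((n + 1 : ℕ) : ℤ) - 1 - x₀).toNat = n := by omega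
  have e3 : (x₀ + ((n + 1 : ℕ) : ℤ) - x₀).toNat = n + 1 := by omega
  simp only [G, e1, e2, e3]
  have h1 : (c (n + 1 + 1)).2 y = extendZero f (x₀ + (n + 1 : ℕ), y) + 4 * (c (n + 1)).2 y
    - (c n).2 y - (c (n + 1)).2 (y + 1) - (c (n + 1)).2 (y - 1) := rfl
  rw [h1, extendZero_of_mem f hxy]
  ring

/-! ### Sandpile classes represented by rational functions. -/

namespace HarmonicRepresents

variable {Γ : Set (ℤ × ℤ)} {H H' : Γ → ℚ} {c c' : SandpileGroup Γ}

lemma add (h : HarmonicRepresents H c) (h' : HarmonicRepresents H' c') :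
    HarmonicRepresents (H + H') (c + c') := by
  obtain ⟨h1, X, h2, rfl⟩ := h
  obtain ⟨h1', X', h2', rfl⟩ := h'
  refine ⟨fun v hv => by simp [h1 v hv, h1' v hv], X + X', fun v => ?_, map_add _ _ _⟩
  simp [h2, h2']
  ring

lemma neg (h : HarmonicRepresents H c) : HarmonicRepresents (-H) (-c) := by
  obtain ⟨h1, X, h2, rfl⟩ := h
  exact ⟨fun v hv => by simp [h1 v hv], -X, fun v => by simp [h2], map_neg _ _⟩

/-- If the class vanishes, then `-ΔH = ΔY` for an integral `Y`, and injectivity of the rational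
Laplacian gives `H = -Y`. Triviality thus becomes a pointwise condition on `H`. -/
lemma eq_zero_iff [Finite Γ] (h : HarmonicRepresents H c) :
    c = 0 ↔ ∃ Y : Γ → ℤ, ∀ v, H v = Y v := by
  obtain ⟨-, X, h2, rfl⟩ := h
  rw [QuotientAddGroup.mk'_apply, QuotientAddGroup.eq_zero_iff, AddMonoidHom.mem_range]
  constructor
  · rintro ⟨Y, rfl⟩
    refine ⟨-Y, fun v => ?_⟩
    have : H = -fun w => (Y w : ℚ) := by
      refine reducedLaplacian_injective Γ ?_
      funext w
      rw [map_neg, Pi.neg_apply, reducedLaplacian_intCast, h2 w, neg_neg]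
    simp [this]
  · rintro ⟨Y, hY⟩
    refine ⟨-Y, ?_⟩
    funext v
    have : H = fun w => (Y w : ℚ) := funext hY
    have h3 := h2 v
    rw [this, reducedLaplacian_intCast] at h3
    rw [map_neg, Pi.neg_apply]
    exact_mod_cast h3.symm

end HarmonicRepresents

/-- A representative `Y` may be changed by an integral `Δg` that agrees with it off the boundary.
Then `ΔH = Δg - Y` is solvable over ℚ and its right-hand side is supported on the boundary. -/
lemma exists_harmonicRepresents {Γ : Set (ℤ × ℤ)} [Finite Γ] (c : SandpileGroup Γ) :
    ∃ H : Γ → ℚ, HarmonicRepresents H c := by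
  obtain ⟨Y, rfl⟩ := QuotientAddGroup.mk'_surjective _ c
  obtain ⟨g, hg⟩ := exists_reducedLaplacian_eq_of_notMem_boundary Γ Y
  obtain ⟨H, hH⟩ := reducedLaplacian_surjective Γ
    (fun v => ((reducedLaplacian Γ ℤ g v - Y v : ℤ) : ℚ))
  refine ⟨H, fun v hv => by simp [hH, hg v hv], Y - reducedLaplacian Γ ℤ g, fun v => ?_, ?_⟩
  · simp [hH]
  · rw [map_sub, sub_eq_self, QuotientAddGroup.mk'_apply, QuotientAddGroup.eq_zero_iff]
    exact ⟨g, rfl⟩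

/-! ### The eight triangles at a lattice vertex. -/

/-- Twice the vector from a lattice vertex to the next vertex of `M` in the direction of angle
`k * 45°`. -/
def rayDir : ZMod 8 → ℤ × ℤ :=
  ![(2, 0), (1, 1), (0, 2), (-1, 1), (-2, 0), (-1, -1), (0, -2), (1, -1)]

/-- The vector from a lattice vertex to the next vertex of `M` in the direction of angle
`k * 45°`. -/
noncomputable def rayVec (k : ZMod 8) : Plane :=
  !₂[((rayDir k).1 : ℝ) / 2, ((rayDir k).2 : ℝ) / 2]

/-- The triangle of `M` at the lattice vertex `v` between the directions of angles `k * 45°` and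
`(k + 1) * 45°`. -/
noncomputable def sector (v : ℤ × ℤ) (k : ZMod 8) : Set Plane :=
  closedTriangle (latticePoint v) (latticePoint v + rayVec k) (latticePoint v + rayVec (k + 1))

/-- The points with positive barycentric coordinates in the triangle `sector v k`. -/
def openSector (v : ℤ × ℤ) (k : ZMod 8) : Set Plane :=
  {x | ∃ a b : ℝ, 0 < a ∧ 0 < b ∧ a + b < 1 ∧
    x = latticePoint v + a • rayVec k + b • rayVec (k + 1)}

@[simp] lemma latticePoint_zero (v : ℤ × ℤ) : latticePoint v 0 = v.1 := by simp [latticePoint]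
@[simp] lemma latticePoint_one (v : ℤ × ℤ) : latticePoint v 1 = v.2 := by simp [latticePoint]
@[simp] lemma apexPoint_zero (v : ℤ × ℤ) : apexPoint v 0 = v.1 + 1 / 2 := by simp [apexPoint]
@[simp] lemma apexPoint_one (v : ℤ × ℤ) : apexPoint v 1 = v.2 + 1 / 2 := by simp [apexPoint]
@[simp] lemma rayVec_zero (k : ZMod 8) : rayVec k 0 = ((rayDir k).1 : ℝ) / 2 := by simp [rayVec]
@[simp] lemma rayVec_one (k : ZMod 8) : rayVec k 1 = ((rayDir k).2 : ℝ) / 2 := by simp [rayVec]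

lemma Plane.ext {x y : Plane} (h0 : x 0 = y 0) (h1 : x 1 = y 1) : x = y := by
  ext i
  fin_cases i
  · exact h0
  · exact h1

lemma latticePoint_injective : Function.Injective latticePoint := by
  intro v w h
  have h0 := congrArg (fun x : Plane => x 0) h
  have h1 := congrArg (fun x : Plane => x 1) h
  simp only [latticePoint_zero, latticePoint_one, Int.cast_inj] at h0 h1
  exact Prod.ext h0 h1

/-- All sectors have the same area and orientation, so Cramer's rule yields barycentric coordinates
uniformly in `k` and without denominators. -/
lemma rayDir_cross (k : ZMod 8) :
    (rayDir k).1 * (rayDir (k + 1)).2 - (rayDir k).2 * (rayDir (k + 1)).1 = 2 := by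
  revert k; decide

lemma rayDir_cross_real (k : ZMod 8) :
    ((rayDir k).1 : ℝ) * (rayDir (k + 1)).2 - (rayDir k).2 * (rayDir (k + 1)).1 = 2 := by
  exact_mod_cast rayDir_cross k

lemma rayVec_ne_zero (k : ZMod 8) : rayVec k ≠ 0 := by
  intro h
  have h0 : rayVec k 0 = 0 := by rw [h]; rfl
  have h1 : rayVec k 1 = 0 := by rw [h]; rfl
  simp only [rayVec_zero, rayVec_one] at h0 h1
  have := rayDir_cross_real k
  have h0' : ((rayDir k).1 : ℝ) = 0 := by linarith
  have h1' : ((rayDir k).2 : ℝ) = 0 := by linarith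
  rw [h0', h1'] at this
  norm_num at this

lemma rayVec_add_four (k : ZMod 8) : rayVec (k + 4) = -rayVec k := by
  have h : rayDir (k + 4) = -rayDir k := by revert k; decide
  apply Plane.ext <;> simp [h] <;> ring

lemma mem_closedTriangle_iff (p y z x : Plane) :
    x ∈ closedTriangle p (p + y) (p + z) ↔
      ∃ a b : ℝ, 0 ≤ a ∧ 0 ≤ b ∧ a + b ≤ 1 ∧ x = p + a • y + b • z := by
  constructor
  · intro hx
    rw [closedTriangle, convexHull_insert (by simp), mem_convexJoin] at hx
    obtain ⟨q, hq, r, hr, s, t, hs, ht, hst, rfl⟩ := hx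
    rw [Set.mem_singleton_iff.1 hq]
    rw [convexHull_pair] at hr
    obtain ⟨s', t', hs', ht', hst', rfl⟩ := hr
    refine ⟨t * s', t * t', by positivity, by positivity, ?_, ?_⟩
    · rw [← mul_add, hst']; linarith
    · obtain rfl : s = 1 - t := by linarith
      obtain rfl : s' = 1 - t' := by linarith
      module
  · rintro ⟨a, b, ha, hb, hab, rfl⟩
    have hc : Convex ℝ (closedTriangle p (p + y) (p + z)) := convex_convexHull ℝ _
    have hsub : {p, p + y, p + z} ⊆ closedTriangle p (p + y) (p + z) := subset_convexHull ℝ _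
    have := hc.sum_mem (t := Finset.univ) (w := ![1 - a - b, a, b])
      (z := ![p, p + y, p + z]) ?_ ?_ ?_
    · convert this using 1
      simp [Fin.sum_univ_three]
      module
    · intro i _; fin_cases i <;> simp <;> linarith
    · simp [Fin.sum_univ_three]; ring
    · intro i _; apply hsub; fin_cases i <;> simp

lemma mem_sector_iff {v : ℤ × ℤ} {k : ZMod 8} {x : Plane} :
    x ∈ sector v k ↔ ∃ a b : ℝ, 0 ≤ a ∧ 0 ≤ b ∧ a + b ≤ 1 ∧
      x = latticePoint v + a • rayVec k + b • rayVec (k + 1) :=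
  mem_closedTriangle_iff _ _ _ _

lemma openSector_subset_sector (v : ℤ × ℤ) (k : ZMod 8) : openSector v k ⊆ sector v k := by
  rintro x ⟨a, b, ha, hb, hab, rfl⟩
  exact mem_sector_iff.2 ⟨a, b, ha.le, hb.le, hab.le, rfl⟩

lemma convex_openSector (v : ℤ × ℤ) (k : ZMod 8) : Convex ℝ (openSector v k) := by
  rintro _ ⟨a, b, ha, hb, hab, rfl⟩ _ ⟨a', b', ha', hb', hab', rfl⟩ s t hs ht hst
  have hpos : ∀ c d : ℝ, 0 < c → 0 < d → 0 < s * c + t * d := by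
    intro c d hc hd
    rcases hs.eq_or_lt with rfl | hs
    · have : t = 1 := by linarith
      subst this; linarith
    · have := mul_pos hs hc
      have := mul_nonneg ht hd.le
      linarith
  refine ⟨s * a + t * a', s * b + t * b', hpos _ _ ha ha', hpos _ _ hb hb', ?_, ?_⟩
  · have := hpos (1 - a - b) (1 - a' - b') (by linarith) (by linarith)
    obtain rfl : s = 1 - t := by linarith
    linarith
  · obtain rfl : s = 1 - t := by linarith
    module

lemma openSector_nonempty (v : ℤ × ℤ) (k : ZMod 8) : (openSector v k).Nonempty :=
  ⟨_, 1 / 3, 1 / 3, by norm_num, by norm_num, by norm_num, rfl⟩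

lemma mem_openSector_iff {v : ℤ × ℤ} {k : ZMod 8} {x : Plane} :
    x ∈ openSector v k ↔
      0 < (x 0 - v.1) * (rayDir (k + 1)).2 - (x 1 - v.2) * (rayDir (k + 1)).1 ∧
      0 < (x 1 - v.2) * (rayDir k).1 - (x 0 - v.1) * (rayDir k).2 ∧
      (x 0 - v.1) * (rayDir (k + 1)).2 - (x 1 - v.2) * (rayDir (k + 1)).1 +
        ((x 1 - v.2) * (rayDir k).1 - (x 0 - v.1) * (rayDir k).2) < 1 := by
  have hc := rayDir_cross_real k
  constructor
  · rintro ⟨a, b, ha, hb, hab, rfl⟩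
    have e1 : ((latticePoint v + a • rayVec k + b • rayVec (k + 1)) 0 - v.1) *
        (rayDir (k + 1)).2 - ((latticePoint v + a • rayVec k + b • rayVec (k + 1)) 1 - v.2) *
        (rayDir (k + 1)).1 = a := by
      simp
      linear_combination a / 2 * hc
    have e2 : ((latticePoint v + a • rayVec k + b • rayVec (k + 1)) 1 - v.2) *
        (rayDir k).1 - ((latticePoint v + a • rayVec k + b • rayVec (k + 1)) 0 - v.1) *
        (rayDir k).2 = b := by
      simp
      linear_combination b / 2 * hc
    rw [e1, e2]
    exact ⟨ha, hb, hab⟩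
  · rintro ⟨h1, h2, h3⟩
    refine ⟨_, _, h1, h2, h3, ?_⟩
    apply Plane.ext
    · simp
      linear_combination -(x 0 - v.1) / 2 * hc
    · simp
      linear_combination -(x 1 - v.2) / 2 * hc

lemma isOpen_openSector (v : ℤ × ℤ) (k : ZMod 8) : IsOpen (openSector v k) := by
  have : openSector v k = {x | _} := Set.ext fun x => mem_openSector_iff
  rw [this]
  refine IsOpen.and ?_ (IsOpen.and ?_ ?_)
  · exact isOpen_lt (by fun_prop) (by fun_prop)
  · exact isOpen_lt (by fun_prop) (by fun_prop)
  · exact isOpen_lt (by fun_prop) (by fun_prop)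

/-- Moving towards the centroid, whose coordinates are `1/3, 1/3`, makes all barycentric coordinates
positive immediately. -/
lemma sector_subset_closure_openSector (v : ℤ × ℤ) (k : ZMod 8) :
    sector v k ⊆ closure (openSector v k) := by
  intro x hx
  obtain ⟨a, b, ha, hb, hab, rfl⟩ := mem_sector_iff.1 hx
  have hcont : Filter.Tendsto (fun t : ℝ => latticePoint v + (a + t * (1 / 3 - a)) • rayVec k +
      (b + t * (1 / 3 - b)) • rayVec (k + 1)) (nhdsWithin 0 (Set.Ioi 0))
      (nhds (latticePoint v + a • rayVec k + b • rayVec (k + 1))) := by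
    refine tendsto_nhdsWithin_of_tendsto_nhds ?_
    have : Continuous (fun t : ℝ => latticePoint v + (a + t * (1 / 3 - a)) • rayVec k +
      (b + t * (1 / 3 - b)) • rayVec (k + 1)) := by fun_prop
    simpa using this.tendsto 0
  refine mem_closure_of_tendsto hcont ?_
  filter_upwards [Ioo_mem_nhdsGT (show (0 : ℝ) < 1 by norm_num)] with t ht
  refine ⟨_, _, ?_, ?_, ?_, rfl⟩ <;> nlinarith [ht.1, ht.2]

lemma closedTriangle_comm₁₂ (a b c : Plane) : closedTriangle a b c = closedTriangle b a c := by
  unfold closedTriangle; congr 1; exact Set.insert_comm _ _ _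

lemma closedTriangle_comm₂₃ (a b c : Plane) : closedTriangle a b c = closedTriangle a c b := by
  unfold closedTriangle; congr 2; exact Set.pair_comm _ _

/-- Each triangle is a sector at both ends of its base. An even index selects the end from which the
triangle lies to the left of the base, which gives a normal form. -/
lemma mem_triangleTiling_iff {m : Set Plane} :
    m ∈ triangleTiling ↔ ∃ v, ∃ k ∈ ({0, 2, 4, 6} : Set (ZMod 8)), m = sector v k := by
  have h0 : ∀ i j : ℤ, closedTriangle (apexPoint (i, j)) (latticePoint (i, j))
      (latticePoint (i + 1, j)) = sector (i, j) 0 := by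
    intro i j
    rw [closedTriangle_comm₁₂, closedTriangle_comm₂₃, sector]
    congr 1 <;> apply Plane.ext <;> simp <;> simp [rayDir]
  have h2 : ∀ i j : ℤ, closedTriangle (apexPoint (i, j)) (latticePoint (i + 1, j))
      (latticePoint (i + 1, j + 1)) = sector (i + 1, j) 2 := by
    intro i j
    rw [closedTriangle_comm₁₂, closedTriangle_comm₂₃, sector]
    have : (2 : ZMod 8) + 1 = 3 := rfl
    rw [this]
    congr 1 <;> apply Plane.ext <;> simp <;> simp [rayDir]; ring
  have h4 : ∀ i j : ℤ, closedTriangle (apexPoint (i, j)) (latticePoint (i, j + 1))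
      (latticePoint (i + 1, j + 1)) = sector (i + 1, j + 1) 4 := by
    intro i j
    rw [closedTriangle_comm₂₃, closedTriangle_comm₁₂, closedTriangle_comm₂₃, sector]
    have : (4 : ZMod 8) + 1 = 5 := rfl
    rw [this]
    congr 1 <;> apply Plane.ext <;> simp <;> simp [rayDir] <;> ring
  have h6 : ∀ i j : ℤ, closedTriangle (apexPoint (i, j)) (latticePoint (i, j))
      (latticePoint (i, j + 1)) = sector (i, j + 1) 6 := by
    intro i j
    rw [closedTriangle_comm₂₃, closedTriangle_comm₁₂, closedTriangle_comm₂₃, sector]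
    have : (6 : ZMod 8) + 1 = 7 := rfl
    rw [this]
    congr 1 <;> apply Plane.ext <;> simp <;> simp [rayDir]; ring
  constructor
  · rintro ⟨i, j, h | h | h | h⟩
    · exact ⟨_, 0, by simp, h.trans (h0 i j)⟩
    · exact ⟨_, 2, by simp, h.trans (h2 i j)⟩
    · exact ⟨_, 4, by simp, h.trans (h4 i j)⟩
    · exact ⟨_, 6, by simp, h.trans (h6 i j)⟩
  · rintro ⟨⟨i, j⟩, k, rfl | rfl | rfl | rfl, h⟩
    · exact ⟨i, j, Or.inl (h.trans (h0 i j).symm)⟩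
    · exact ⟨i - 1, j, Or.inr (Or.inl (by rw [h2, sub_add_cancel, h]))⟩
    · exact ⟨i - 1, j - 1, Or.inr (Or.inr (Or.inl (by rw [h4, sub_add_cancel, sub_add_cancel, h])))⟩
    · exact ⟨i, j - 1, Or.inr (Or.inr (Or.inr (by rw [h6, sub_add_cancel, h])))⟩

/-- The step from a lattice vertex to its neighbour in the direction of angle `k * 45°`. -/
def axisStep (k : ZMod 8) : ℤ × ℤ := ((rayDir k).1 / 2, (rayDir k).2 / 2)

/-- In `ZMod 8` the condition `4 * k = 0` means that `k` is even: the ray runs along an axis and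
ends at a lattice vertex rather than at an apex. -/
lemma rayDir_of_axis {k : ZMod 8} (hk : 4 * k = 0) :
    rayDir k = (2 * (axisStep k).1, 2 * (axisStep k).2) := by
  revert k; decide

lemma latticePoint_add_rayVec {k : ZMod 8} (hk : 4 * k = 0) (v : ℤ × ℤ) :
    latticePoint v + rayVec k = latticePoint (v + axisStep k) := by
  have := rayDir_of_axis hk
  apply Plane.ext <;> simp <;> rw [this] <;> push_cast <;> ring

lemma axis_or_axis_add_one (k : ZMod 8) : 4 * k = 0 ∨ 4 * (k + 1) = 0 := by
  revert k; decide

/-- The triangle at the end of an axis ray, on the left of it. -/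
lemma sector_eq_sector_left {k : ZMod 8} (hk : 4 * k = 0) (v : ℤ × ℤ) :
    sector v k = sector (v + axisStep k) (k + 3) := by
  have h1 : rayDir (k + 3 + 1) = -rayDir k := by revert k; decide
  have h2 : rayDir (k + 3) = rayDir (k + 1) - rayDir k := by revert k; decide
  rw [sector, sector, closedTriangle_comm₁₂, closedTriangle_comm₂₃, ← latticePoint_add_rayVec hk]
  congr 1 <;> apply Plane.ext <;> simp [h1, h2] <;> ring

/-- The triangle at the end of an axis ray, on the right of it. -/
lemma sector_eq_sector_right {k : ZMod 8} (hk : 4 * (k + 1) = 0) (v : ℤ × ℤ) :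
    sector v k = sector (v + axisStep (k + 1)) (k + 5) := by
  have h1 : rayDir (k + 5) = -rayDir (k + 1) := by revert k; decide
  have h2 : rayDir (k + 5 + 1) = rayDir k - rayDir (k + 1) := by revert k; decide
  rw [sector, sector, closedTriangle_comm₂₃, closedTriangle_comm₁₂, closedTriangle_comm₂₃,
    ← latticePoint_add_rayVec hk, closedTriangle_comm₂₃]
  congr 1 <;> apply Plane.ext <;> simp [h1, h2] <;> ring

lemma mem_zero_two_four_six_iff {k : ZMod 8} : k ∈ ({0, 2, 4, 6} : Set (ZMod 8)) ↔ 4 * k = 0 := by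
  simp only [Set.mem_insert_iff, Set.mem_singleton_iff]
  revert k; decide

lemma sector_mem_triangleTiling (v : ℤ × ℤ) (k : ZMod 8) : sector v k ∈ triangleTiling := by
  rw [mem_triangleTiling_iff]
  rcases axis_or_axis_add_one k with hk | hk
  · exact ⟨v, k, mem_zero_two_four_six_iff.2 hk, rfl⟩
  · exact ⟨_, k + 5, mem_zero_two_four_six_iff.2 (by revert k; decide), sector_eq_sector_right hk v⟩

/-- The position of the vertex `v` in the unit square that contains `sector v k`, for `k` in
`{0, 2, 4, 6}`. -/
def squareCorner : ZMod 8 → ℤ × ℤ :=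
  ![(0, 0), (0, 0), (1, 0), (0, 0), (1, 1), (0, 0), (0, 1), (0, 0)]

lemma coords_of_axis {v : ℤ × ℤ} {k : ZMod 8} {x : Plane} {a b : ℝ} (hk : 4 * k = 0)
    (hx : x = latticePoint v + a • rayVec k + b • rayVec (k + 1)) :
    (k = 0 ∧ squareCorner k = (0, 0) ∧ x 0 = v.1 + a + b / 2 ∧ x 1 = v.2 + b / 2) ∨
    (k = 2 ∧ squareCorner k = (1, 0) ∧ x 0 = v.1 - b / 2 ∧ x 1 = v.2 + a + b / 2) ∨
    (k = 4 ∧ squareCorner k = (1, 1) ∧ x 0 = v.1 - a - b / 2 ∧ x 1 = v.2 - b / 2) ∨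
    (k = 6 ∧ squareCorner k = (0, 1) ∧ x 0 = v.1 + b / 2 ∧ x 1 = v.2 - a - b / 2) := by
  rcases mem_zero_two_four_six_iff.2 hk with rfl | rfl | rfl | rfl
  · left
    refine ⟨rfl, rfl, ?_, ?_⟩ <;> simp [hx, rayDir] <;> ring
  · right; left
    have h1 : (2 : ZMod 8) + 1 = 3 := rfl
    refine ⟨rfl, rfl, ?_, ?_⟩ <;> simp [hx, h1, rayDir] <;> ring
  · right; right; left
    have h1 : (4 : ZMod 8) + 1 = 5 := rfl
    refine ⟨rfl, rfl, ?_, ?_⟩ <;> simp [hx, h1, rayDir] <;> ring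
  · right; right; right
    have h1 : (6 : ZMod 8) + 1 = 7 := rfl
    refine ⟨rfl, rfl, ?_, ?_⟩ <;> simp [hx, h1, rayDir] <;> ring

/-- A point of the open triangle lies strictly inside one unit square, so both triangles belong to
that square. Within it the diagonals separate the four triangles. -/
lemma eq_of_mem_openSector_of_mem_sector {v w : ℤ × ℤ} {k l : ZMod 8} {x : Plane}
    (hk : 4 * k = 0) (hl : 4 * l = 0) (hx : x ∈ openSector v k) (hx' : x ∈ sector w l) :
    v = w ∧ k = l := by
  obtain ⟨a, b, ha, hb, hab, h⟩ := hx
  obtain ⟨a', b', ha', hb', hab', h'⟩ := mem_sector_iff.1 hx'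
  have key := coords_of_axis hk h
  have key' := coords_of_axis hl h'
  clear h h' hx'
  have b1 : ((v.1 - (squareCorner k).1 : ℤ) : ℝ) < x 0 ∧
      x 0 < ((v.1 - (squareCorner k).1 : ℤ) : ℝ) + 1 ∧
      ((v.2 - (squareCorner k).2 : ℤ) : ℝ) < x 1 ∧
      x 1 < ((v.2 - (squareCorner k).2 : ℤ) : ℝ) + 1 := by
    rcases key with ⟨-, h, h0, h1⟩ | ⟨-, h, h0, h1⟩ | ⟨-, h, h0, h1⟩ | ⟨-, h, h0, h1⟩ <;>
      rw [h, h0, h1] <;> push_cast <;> refine ⟨?_, ?_, ?_, ?_⟩ <;> linarith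
  have b2 : ((w.1 - (squareCorner l).1 : ℤ) : ℝ) ≤ x 0 ∧
      x 0 ≤ ((w.1 - (squareCorner l).1 : ℤ) : ℝ) + 1 ∧
      ((w.2 - (squareCorner l).2 : ℤ) : ℝ) ≤ x 1 ∧
      x 1 ≤ ((w.2 - (squareCorner l).2 : ℤ) : ℝ) + 1 := by
    rcases key' with ⟨-, h, h0, h1⟩ | ⟨-, h, h0, h1⟩ | ⟨-, h, h0, h1⟩ | ⟨-, h, h0, h1⟩ <;>
      rw [h, h0, h1] <;> push_cast <;> refine ⟨?_, ?_, ?_, ?_⟩ <;> linarith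
  have e1 : v.1 - (squareCorner k).1 = w.1 - (squareCorner l).1 := by
    apply le_antisymm <;> apply Int.lt_add_one_iff.1
    · exact_mod_cast b1.1.trans_le b2.2.1
    · exact_mod_cast b2.1.trans_lt b1.2.1
  have e2 : v.2 - (squareCorner k).2 = w.2 - (squareCorner l).2 := by
    apply le_antisymm <;> apply Int.lt_add_one_iff.1
    · exact_mod_cast b1.2.2.1.trans_le b2.2.2.2
    · exact_mod_cast b2.2.2.1.trans_lt b1.2.2.2
  clear b1 b2
  have e1' : (v.1 : ℝ) - (squareCorner k).1 = w.1 - (squareCorner l).1 := by exact_mod_cast e1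
  have e2' : (v.2 : ℝ) - (squareCorner k).2 = w.2 - (squareCorner l).2 := by exact_mod_cast e2
  have hkl : k = l := by
    rcases key with ⟨rfl, h, h0, h1⟩ | ⟨rfl, h, h0, h1⟩ | ⟨rfl, h, h0, h1⟩ | ⟨rfl, h, h0, h1⟩ <;>
    rcases key' with ⟨rfl, h', h0', h1'⟩ | ⟨rfl, h', h0', h1'⟩ | ⟨rfl, h', h0', h1'⟩ |
      ⟨rfl, h', h0', h1'⟩ <;> first
    | rfl
    | (exfalso; rw [h, h'] at e1' e2'; push_cast at e1' e2'; linarith)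
  subst hkl
  exact ⟨Prod.ext (by linarith) (by linarith), rfl⟩

lemma axis_add_five {k : ZMod 8} (hk : 4 * (k + 1) = 0) : 4 * (k + 5) = 0 := by
  revert k; decide

lemma openSector_subset_openSector_right {k : ZMod 8} (hk : 4 * (k + 1) = 0) (v : ℤ × ℤ) :
    openSector v k ⊆ openSector (v + axisStep (k + 1)) (k + 5) := by
  have h3 : rayDir (k + 5 + 1) = rayDir k - rayDir (k + 1) := by revert k; decide
  have h1 : rayVec (k + 5) = -rayVec (k + 1) := by
    rw [← rayVec_add_four]; congr 1; ring
  have h2 : rayVec (k + 5 + 1) = rayVec k - rayVec (k + 1) := by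
    apply Plane.ext <;> simp [h3] <;> ring
  rintro _ ⟨a, b, ha, hb, hab, rfl⟩
  -- These are the barycentric coordinates relative to the other end of the base.
  refine ⟨1 - a - b, a, by linarith, ha, by linarith, ?_⟩
  rw [h1, h2, ← latticePoint_add_rayVec hk]
  module

lemma eq_sector_of_mem_openSector {v : ℤ × ℤ} {k : ZMod 8} {x : Plane} {m : Set Plane}
    (hm : m ∈ triangleTiling) (hx : x ∈ openSector v k) (hxm : x ∈ m) : m = sector v k := by
  obtain ⟨w, l, hl, rfl⟩ := mem_triangleTiling_iff.1 hm
  rw [mem_zero_two_four_six_iff] at hl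
  rcases axis_or_axis_add_one k with hk | hk
  · obtain ⟨rfl, rfl⟩ := eq_of_mem_openSector_of_mem_sector hk hl hx hxm
    rfl
  · obtain ⟨rfl, rfl⟩ := eq_of_mem_openSector_of_mem_sector (axis_add_five hk) hl
      (openSector_subset_openSector_right hk v hx) hxm
    exact (sector_eq_sector_right hk v).symm

lemma sector_zero_injective : Function.Injective fun v => sector v 0 := by
  intro v w h
  obtain ⟨x, hx⟩ := openSector_nonempty v 0
  have hxw : x ∈ sector w 0 := by
    have := openSector_subset_sector v 0 hx
    rwa [show sector v 0 = sector w 0 from h] at this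
  exact (eq_of_mem_openSector_of_mem_sector (mul_zero _) (mul_zero _) hx hxw).1

lemma latticePoint_mem_sector (v : ℤ × ℤ) (k : ZMod 8) : latticePoint v ∈ sector v k :=
  subset_convexHull ℝ _ (by simp)

lemma add_rayVec_mem_sector (v : ℤ × ℤ) (k : ZMod 8) : latticePoint v + rayVec k ∈ sector v k :=
  subset_convexHull ℝ _ (by simp)

lemma add_rayVec_succ_mem_sector (v : ℤ × ℤ) (k : ZMod 8) :
    latticePoint v + rayVec (k + 1) ∈ sector v k :=
  subset_convexHull ℝ _ (by simp)

lemma openSector_subset_enclosedRegion {S : Set (Set Plane)} {v : ℤ × ℤ} {k : ZMod 8}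
    (h : sector v k ∈ S) : openSector v k ⊆ enclosedRegion S :=
  interior_maximal ((openSector_subset_sector v k).trans (Set.subset_sUnion_of_mem h))
    (isOpen_openSector v k)

lemma sector_mem_of_mem_enclosedRegion {S : Set (Set Plane)} (hS : S ⊆ triangleTiling)
    {v : ℤ × ℤ} {k : ZMod 8} {x : Plane} (hx : x ∈ openSector v k) (hxS : x ∈ enclosedRegion S) :
    sector v k ∈ S := by
  obtain ⟨m, hm, hxm⟩ := interior_subset hxS
  rwa [← eq_sector_of_mem_openSector (hS hm) hx hxm]

lemma mem_sector_of_coords {v : ℤ × ℤ} (k : ZMod 8) {p q p' q' : ℤ} (hp : rayDir k = (p, q))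
    (hp' : rayDir (k + 1) = (p', q')) {x : Plane}
    (h1 : 0 ≤ (x 0 - v.1) * q' - (x 1 - v.2) * p')
    (h2 : 0 ≤ (x 1 - v.2) * p - (x 0 - v.1) * q)
    (h3 : (x 0 - v.1) * q' - (x 1 - v.2) * p' + ((x 1 - v.2) * p - (x 0 - v.1) * q) ≤ 1) :
    x ∈ sector v k := by
  have hc := rayDir_cross_real k
  rw [hp, hp'] at hc
  refine mem_sector_iff.2 ⟨_, _, h1, h2, h3, ?_⟩
  apply Plane.ext
  · simp [hp, hp']
    linear_combination -(x 0 - v.1) / 2 * hc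
  · simp [hp, hp']
    linear_combination -(x 1 - v.2) / 2 * hc

/-- The eight triangles fill the ℓ¹ ball of radius 1; the signs of the coordinates and a comparison
of their sizes select the octant. -/
lemma exists_mem_sector {v : ℤ × ℤ} {x : Plane} (h : |x 0 - v.1| + |x 1 - v.2| < 1) :
    ∃ k, x ∈ sector v k := by
  rcases le_total 0 (x 0 - v.1) with hs | hs <;> rcases le_total 0 (x 1 - v.2) with ht | ht <;>
    simp only [abs_of_nonneg, abs_of_nonpos, hs, ht] at h
  · rcases le_total (x 1 - v.2) (x 0 - v.1) with hst | hst
    · refine ⟨0, mem_sector_of_coords 0 rfl rfl ?_ ?_ ?_⟩ <;> push_cast <;> linarith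
    · refine ⟨1, mem_sector_of_coords 1 rfl rfl ?_ ?_ ?_⟩ <;> push_cast <;> linarith
  · rcases le_total (-(x 1 - v.2)) (x 0 - v.1) with hst | hst
    · refine ⟨7, mem_sector_of_coords 7 rfl rfl ?_ ?_ ?_⟩ <;> push_cast <;> linarith
    · refine ⟨6, mem_sector_of_coords 6 rfl rfl ?_ ?_ ?_⟩ <;> push_cast <;> linarith
  · rcases le_total (x 1 - v.2) (-(x 0 - v.1)) with hst | hst
    · refine ⟨3, mem_sector_of_coords 3 rfl rfl ?_ ?_ ?_⟩ <;> push_cast <;> linarith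
    · refine ⟨2, mem_sector_of_coords 2 rfl rfl ?_ ?_ ?_⟩ <;> push_cast <;> linarith
  · rcases le_total (x 1 - v.2) (x 0 - v.1) with hst | hst
    · refine ⟨5, mem_sector_of_coords 5 rfl rfl ?_ ?_ ?_⟩ <;> push_cast <;> linarith
    · refine ⟨4, mem_sector_of_coords 4 rfl rfl ?_ ?_ ?_⟩ <;> push_cast <;> linarith

/-- A lattice vertex is enclosed by a set of triangles iff all eight triangles at it belong to
the set. -/
lemma latticePoint_mem_enclosedRegion_iff {S : Set (Set Plane)} (hS : S ⊆ triangleTiling)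
    {v : ℤ × ℤ} : latticePoint v ∈ enclosedRegion S ↔ ∀ k, sector v k ∈ S := by
  constructor
  · intro h k
    obtain ⟨x, hxS, hx⟩ := mem_closure_iff.1
      (sector_subset_closure_openSector v k (latticePoint_mem_sector v k)) _ isOpen_interior h
    exact sector_mem_of_mem_enclosedRegion hS hx hxS
  · intro h
    refine mem_interior.2 ⟨{x : Plane | |x 0 - v.1| + |x 1 - v.2| < 1}, ?_, ?_, by simp⟩
    · intro x hx
      obtain ⟨k, hk⟩ := exists_mem_sector hx
      exact ⟨_, h k, hk⟩
    · exact isOpen_lt (by fun_prop) (by fun_prop)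

/-- The vertex is the midpoint of the centroids of the two opposite triangles. -/
lemma latticePoint_mem_of_opposite_sectors {S : Set (Set Plane)}
    (hc : Convex ℝ (enclosedRegion S)) {v : ℤ × ℤ} {k : ZMod 8} (h : sector v k ∈ S)
    (h' : sector v (k + 4) ∈ S) : latticePoint v ∈ enclosedRegion S := by
  have h1 := openSector_subset_enclosedRegion h
    ⟨1 / 3, 1 / 3, by norm_num, by norm_num, by norm_num, rfl⟩
  have h2 := openSector_subset_enclosedRegion h'
    ⟨1 / 3, 1 / 3, by norm_num, by norm_num, by norm_num, rfl⟩
  have := hc h1 h2 (a := 1 / 2) (b := 1 / 2) (by norm_num) (by norm_num) (by norm_num)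
  convert this using 1
  rw [rayVec_add_four, show k + 4 + 1 = k + 1 + 4 by ring, rayVec_add_four]
  module

lemma Polyform.mem_domain_iff (P : Polyform) {v : ℤ × ℤ} :
    v ∈ P.domain ↔ ∀ k, sector v k ∈ P.triangles :=
  latticePoint_mem_enclosedRegion_iff P.subset_tiling

instance Polyform.finite_domain (P : Polyform) : Finite P.domain :=
  (P.finite.preimage sector_zero_injective.injOn).subset fun _ hv => P.mem_domain_iff.1 hv 0

lemma Polyform.triangles_nonempty (P : Polyform) : P.triangles.Nonempty := by
  obtain ⟨x, hx⟩ := P.connected.nonempty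
  obtain ⟨m, hm, -⟩ := interior_subset hx
  exact ⟨m, hm⟩

/-! ### Automorphisms of the tiling -/

lemma dist_sq_eq (x y : Plane) : dist x y ^ 2 = (x 0 - y 0) ^ 2 + (x 1 - y 1) ^ 2 := by
  rw [EuclideanSpace.dist_sq_eq, Fin.sum_univ_two, Real.dist_eq, Real.dist_eq, sq_abs, sq_abs]

lemma dist_latticePoint_eq_one_iff (v w : ℤ × ℤ) :
    dist (latticePoint v) (latticePoint w) = 1 ↔ w ∈ latticeNeighbors v := by
  have h1 : dist (latticePoint v) (latticePoint w) = 1 ↔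
      (v.1 - w.1) ^ 2 + (v.2 - w.2) ^ 2 = 1 := by
    rw [← sq_eq_sq₀ dist_nonneg zero_le_one, dist_sq_eq]
    simp only [latticePoint_zero, latticePoint_one]
    rw [one_pow]
    exact_mod_cast Iff.rfl
  rw [h1]
  obtain ⟨a, b⟩ := v
  obtain ⟨c, d⟩ := w
  simp only [latticeNeighbors, Finset.mem_insert, Finset.mem_singleton, Prod.mk.injEq]
  constructor
  · intro h
    have h2 : -1 ≤ a - c := by nlinarith
    have h3 : a - c ≤ 1 := by nlinarith
    have h4 : -1 ≤ b - d := by nlinarith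
    have h5 : b - d ≤ 1 := by nlinarith
    obtain ⟨s, hs⟩ : ∃ s, s = a - c := ⟨_, rfl⟩
    obtain ⟨t, ht⟩ : ∃ t, t = b - d := ⟨_, rfl⟩
    rw [← hs] at h h2 h3
    rw [← ht] at h h4 h5
    interval_cases s <;> interval_cases t <;> simp at h <;> omega
  · rintro (⟨rfl, rfl⟩ | ⟨rfl, rfl⟩ | ⟨rfl, rfl⟩ | ⟨rfl, rfl⟩) <;> ring

/-- Distance 1 is the diameter of a triangle of `M` and is attained only by the ends of its base.
Hence automorphisms of `M` preserve the lattice. -/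
lemma exists_latticePoint_of_dist_eq_one {m : Set Plane} (hm : m ∈ triangleTiling) {x y : Plane}
    (hx : x ∈ m) (hy : y ∈ m) (h : dist x y = 1) : ∃ v, latticePoint v = x := by
  obtain ⟨v, k, hk, rfl⟩ := mem_triangleTiling_iff.1 hm
  rw [mem_zero_two_four_six_iff] at hk
  obtain ⟨a, b, ha, hb, hab, hx⟩ := mem_sector_iff.1 hx
  obtain ⟨a', b', ha', hb', hab', hy⟩ := mem_sector_iff.1 hy
  have hd : (a + b / 2 - a' - b' / 2) ^ 2 + (b / 2 - b' / 2) ^ 2 = 1 := by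
    have h2 := dist_sq_eq x y
    rw [h] at h2
    rcases coords_of_axis hk hx with ⟨rfl, -, h0, h1⟩ | ⟨rfl, -, h0, h1⟩ | ⟨rfl, -, h0, h1⟩ |
      ⟨rfl, -, h0, h1⟩ <;>
    rcases coords_of_axis hk hy with ⟨hk', -, h0', h1'⟩ | ⟨hk', -, h0', h1'⟩ |
      ⟨hk', -, h0', h1'⟩ | ⟨hk', -, h0', h1'⟩ <;>
    first
    | exact absurd hk' (by decide)
    | (rw [h0, h1, h0', h1'] at h2; linear_combination -h2)
  have hb0 : b = 0 ∧ (a = 0 ∨ a = 1) := by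
    -- Inserted into `hd`, this bound gives `b(1 - b/2) + b'(1 - b'/2) ≤ 0`, which forces both
    -- points onto the base.
    have h1 : (a + b / 2 - a' - b' / 2) ^ 2 ≤ (1 - b / 2 - b' / 2) ^ 2 :=
      sq_le_sq' (by linarith) (by linarith)
    have h2 : 0 ≤ b' * (1 - b' / 2) := mul_nonneg hb' (by linarith)
    have h3 : b * (1 - b / 2) ≤ 0 := by nlinarith
    have h4 : b = 0 := by nlinarith
    subst h4
    have h5 : b' * (1 - b' / 2) ≤ 0 := by nlinarith
    have h6 : b' = 0 := by nlinarith
    subst h6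
    have h7 : (a - a' - 1) * (a - a' + 1) = 0 := by linear_combination hd
    rcases mul_eq_zero.1 h7 with h | h
    · exact ⟨rfl, Or.inr (by linarith)⟩
    · exact ⟨rfl, Or.inl (by linarith)⟩
  obtain ⟨rfl, rfl | rfl⟩ := hb0
  · exact ⟨v, by rw [hx]; simp⟩
  · exact ⟨v + axisStep k, by rw [hx, ← latticePoint_add_rayVec hk]; simp⟩

namespace IsTilingAut

variable {g : Plane ≃ᵃⁱ[ℝ] Plane}

lemma image_mem (hg : IsTilingAut g) {m : Set Plane} (hm : m ∈ triangleTiling) :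
    g '' m ∈ triangleTiling := by
  have h : (fun m : Set Plane => g '' m) '' triangleTiling = triangleTiling := hg
  rw [← h]
  exact ⟨m, hm, rfl⟩

lemma symm (hg : IsTilingAut g) : IsTilingAut g.symm := by
  have h : (fun m : Set Plane => g '' m) '' triangleTiling = triangleTiling := hg
  change (fun m : Set Plane => g.symm '' m) '' triangleTiling = triangleTiling
  conv_lhs => rw [← h]
  rw [Set.image_image]
  simp [Set.image_image]

lemma exists_latticePoint (hg : IsTilingAut g) (v : ℤ × ℤ) :
    ∃ w, latticePoint w = g (latticePoint v) := by
  refine exists_latticePoint_of_dist_eq_one (hg.image_mem (sector_mem_triangleTiling v 0))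
    (Set.mem_image_of_mem _ (latticePoint_mem_sector v 0))
    (Set.mem_image_of_mem _ (add_rayVec_mem_sector v 0)) ?_
  rw [g.dist_map, latticePoint_add_rayVec (mul_zero _), dist_latticePoint_eq_one_iff]
  have : axisStep 0 = (1, 0) := rfl
  simp [latticeNeighbors, this, Prod.ext_iff]

/-- The permutation of the lattice induced by an automorphism of the tiling. -/
noncomputable def latticePerm (hg : IsTilingAut g) : (ℤ × ℤ) ≃ (ℤ × ℤ) where
  toFun v := (hg.exists_latticePoint v).choose
  invFun v := (hg.symm.exists_latticePoint v).choose
  left_inv v := latticePoint_injective <| by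
    rw [(hg.symm.exists_latticePoint _).choose_spec, (hg.exists_latticePoint _).choose_spec,
      g.symm_apply_apply]
  right_inv v := latticePoint_injective <| by
    rw [(hg.exists_latticePoint _).choose_spec, (hg.symm.exists_latticePoint _).choose_spec,
      g.apply_symm_apply]

lemma latticePoint_latticePerm (hg : IsTilingAut g) (v : ℤ × ℤ) :
    latticePoint (hg.latticePerm v) = g (latticePoint v) :=
  (hg.exists_latticePoint v).choose_spec

lemma latticePoint_latticePerm_symm (hg : IsTilingAut g) (v : ℤ × ℤ) :
    latticePoint (hg.latticePerm.symm v) = g.symm (latticePoint v) :=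
  (hg.symm.exists_latticePoint v).choose_spec

lemma latticePerm_symm_mem_latticeNeighbors (hg : IsTilingAut g) (v w : ℤ × ℤ) :
    hg.latticePerm.symm w ∈ latticeNeighbors (hg.latticePerm.symm v) ↔ w ∈ latticeNeighbors v := by
  rw [← dist_latticePoint_eq_one_iff, ← dist_latticePoint_eq_one_iff,
    latticePoint_latticePerm_symm, latticePoint_latticePerm_symm, g.symm.dist_map]

lemma sum_latticeNeighbors_latticePerm_symm {R : Type*} [AddCommMonoid R] (hg : IsTilingAut g)
    (F : ℤ × ℤ → R) (v : ℤ × ℤ) :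
    ∑ w ∈ latticeNeighbors v, F (hg.latticePerm.symm w) =
      ∑ w ∈ latticeNeighbors (hg.latticePerm.symm v), F w :=
  Finset.sum_equiv hg.latticePerm.symm
    (fun w => (hg.latticePerm_symm_mem_latticeNeighbors v w).symm) fun _ _ => rfl

end IsTilingAut

/-! ### Cancellation around a vertex under reflections. -/

lemma sum_zmod_eight {R : Type*} [AddCommMonoid R] (h : ZMod 8 → R) :
    ∑ k, h k = h 0 + h 1 + h 2 + h 3 + h 4 + h 5 + h 6 + h 7 :=
  Fin.sum_univ_eight (fun k : Fin 8 => h k)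

/-- Ray `k` lies between sectors `k - 1` and `k`; `hleft` and `hright` cover the cases where the
sector to the left or to the right of ray `k + 1 + m` has the label of sector `k + 1`. With `m = 0`,
`h` vanishes on every separating ray. The cases are the width of the block of sectors that starts at
ray 1. Width 4 gives two half-planes exchanged by one reflection, width 2 gives four quadrants,
width 1 makes every ray separating, and width 3 contradicts the reflections. -/
lemma sum_eq_zero_of_reflections_aux {ι : Type*} (t : ZMod 8 → ι) (h : ZMod 8 → ℚ)
    (h4 : ∀ k, t (k + 4) ≠ t k)
    (htile : ∀ k, t k ≠ t (k + 1) → ∀ m, t (k + 1 + m) = t (k + 1) ↔ t (k - m) = t k)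
    (hleft : ∀ k, t k ≠ t (k + 1) → ∀ m, t (k + 1 + m) = t (k + 1) →
      h (k + 1 + m) = -h (k + 1 - m))
    (hright : ∀ k, t k ≠ t (k + 1) → ∀ m, t (k + m) = t (k + 1) →
      h (k + 1 + m) = -h (k + 1 - m)) (h01 : t 0 ≠ t 1) :
    ∑ k, h k = 0 := by
  have hsum := sum_zmod_eight h
  have hzero : ∀ k, t k ≠ t (k + 1) → h (k + 1) = 0 := fun k hk => by
    have := hleft k hk 0 (by rw [add_zero])
    rw [add_zero, sub_zero] at this
    linarith
  have h1 : h 1 = 0 := hzero 0 h01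
  have r1 : t 2 = t 1 ↔ t 7 = t 0 := htile 0 h01 1
  have r2 : t 3 = t 1 ↔ t 6 = t 0 := htile 0 h01 2
  have r3 : t 4 = t 1 ↔ t 5 = t 0 := htile 0 h01 3
  have h51 : t 5 ≠ t 1 := h4 1
  by_cases h21 : t 2 = t 1
  · have l1 : h 2 = -h 0 := hleft 0 h01 1 h21
    have l2 : h 3 = -h 7 := hright 0 h01 2 h21
    have h70 := r1.1 h21
    by_cases h31 : t 3 = t 1
    · have l3 : h 4 = -h 6 := hright 0 h01 3 h31
      have h60 := r2.1 h31
      by_cases h41 : t 4 = t 1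
      · have l4 : h 5 = -h 5 := hright 0 h01 4 h41
        linarith
      · have b3 : t 3 ≠ t 4 := fun e => h41 (e.symm.trans h31)
        have s1 : t 5 = t 4 ↔ t 2 = t 3 := htile 3 b3 1
        have s2 : t 6 = t 4 ↔ t 1 = t 3 := htile 3 b3 2
        have e5 := s1.2 (h21.trans h31.symm)
        have e6 := s2.2 h31.symm
        exact absurd (r3.2 (e5.trans (e6.symm.trans h60))) h41
    · have b2 : t 2 ≠ t 3 := fun e => h31 (e.symm.trans h21)
      have h60 : t 6 ≠ t 0 := fun e => h31 (r2.2 e)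
      have b6 : t 6 ≠ t 7 := fun e => h60 (e.trans h70)
      have s1 : t 4 = t 3 ↔ t 1 = t 2 := htile 2 b2 1
      have s2 : t 5 = t 3 ↔ t 0 = t 2 := htile 2 b2 2
      have h43 := s1.2 h21.symm
      have h53 : t 5 ≠ t 3 := fun e => h01 ((s2.1 e).trans h21)
      have b4 : t 4 ≠ t 5 := fun e => h53 (e.symm.trans h43)
      have s3 : t 6 = t 5 ↔ t 3 = t 4 := htile 4 b4 1
      have h65 := s3.2 h43.symm
      have h3 : h 3 = 0 := hzero 2 b2
      have h5 : h 5 = 0 := hzero 4 b4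
      have h7 : h 7 = 0 := hzero 6 b6
      have l6 : h 6 = -h 4 := hleft 4 b4 1 h65
      linarith
  · have step : ∀ k, t k ≠ t (k + 1) → t (k + 1) ≠ t (k + 2) → t (k + 2) ≠ t (k + 3) := by
      intro k a b e
      have e2 : k + 1 + 1 = k + 2 := by ring
      have e3 : k + 1 + 1 + 1 = k + 3 := by ring
      have e4 : k + 1 - 1 = k := by ring
      have := htile (k + 1) (by rwa [e2]) 1
      rw [e3, e2, e4] at this
      exact a (this.1 e.symm)
    have b1 : t 1 ≠ t 2 := fun e => h21 e.symm
    have b2 : t 2 ≠ t 3 := step 0 h01 b1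
    have b3 : t 3 ≠ t 4 := step 1 b1 b2
    have b4 : t 4 ≠ t 5 := step 2 b2 b3
    have b5 : t 5 ≠ t 6 := step 3 b3 b4
    have b6 : t 6 ≠ t 7 := step 4 b4 b5
    have b7 : t 7 ≠ t 0 := step 5 b5 b6
    have h2 : h 2 = 0 := hzero 1 b1
    have h3 : h 3 = 0 := hzero 2 b2
    have h4 : h 4 = 0 := hzero 3 b3
    have h5 : h 5 = 0 := hzero 4 b4
    have h6 : h 6 = 0 := hzero 5 b5
    have h7 : h 7 = 0 := hzero 6 b6
    have h0 : h 0 = 0 := hzero 7 b7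
    linarith

/-- Let `t` label the eight sectors at a vertex, no label covering two opposite sectors, such that
whenever consecutive sectors have different labels, the reflection in the ray between them
exchanges the labels and changes the sign of `h`. Then `h` has sum `0` over the eight rays. -/
lemma sum_eq_zero_of_reflections {ι : Type*} (t : ZMod 8 → ι) (h : ZMod 8 → ℚ)
    (h4 : ∀ k, t (k + 4) ≠ t k)
    (htile : ∀ k, t k ≠ t (k + 1) → ∀ m, t (k + 1 + m) = t (k + 1) ↔ t (k - m) = t k)
    (hleft : ∀ k, t k ≠ t (k + 1) → ∀ m, t (k + 1 + m) = t (k + 1) →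
      h (k + 1 + m) = -h (k + 1 - m))
    (hright : ∀ k, t k ≠ t (k + 1) → ∀ m, t (k + m) = t (k + 1) →
      h (k + 1 + m) = -h (k + 1 - m)) :
    ∑ k, h k = 0 := by
  obtain ⟨c, hc⟩ : ∃ c, t c ≠ t (c + 1) := by
    by_contra! hcon
    exact h4 0 ((((hcon 0).trans (hcon 1)).trans (hcon 2)).trans (hcon 3)).symm
  rw [← Equiv.sum_comp (Equiv.addLeft c) h]
  refine sum_eq_zero_of_reflections_aux (fun k => t (c + k)) (fun k => h (c + k)) ?_ ?_ ?_ ?_ ?_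
  · intro k
    have := h4 (c + k)
    rwa [add_assoc] at this
  · intro k hk m
    have := htile (c + k) (by rwa [add_assoc]) m
    simpa only [add_assoc, add_sub_assoc] using this
  · intro k hk m hm
    have := hleft (c + k) (by rwa [add_assoc]) m (by simpa only [add_assoc] using hm)
    simpa only [add_assoc, add_sub_assoc] using this
  · intro k hk m hm
    have := hright (c + k) (by rwa [add_assoc]) m (by simpa only [add_assoc] using hm)
    simpa only [add_assoc, add_sub_assoc] using this
  · simpa using hc

/-! ### Reflections -/

lemma affineIsometryEquiv_apply_add (R : Plane ≃ᵃⁱ[ℝ] Plane) {x : Plane} (hx : R x = x)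
    (y : Plane) : R (x + y) = x + R.linearIsometryEquiv y := by
  have := R.map_vadd x y
  rw [vadd_eq_add, vadd_eq_add, hx] at this
  rw [add_comm, this, add_comm]

lemma Plane.sq_add_sq_ne_zero {d : Plane} (hd : d ≠ 0) : d 0 ^ 2 + d 1 ^ 2 ≠ 0 := by
  intro h
  apply hd
  apply Plane.ext
  · exact pow_eq_zero_iff two_ne_zero |>.1 (by nlinarith [sq_nonneg (d 0), sq_nonneg (d 1)])
  · exact pow_eq_zero_iff two_ne_zero |>.1 (by nlinarith [sq_nonneg (d 0), sq_nonneg (d 1)])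

/-- A linear isometry of the plane that is not the identity and fixes a vector `d ≠ 0` is the
reflection in the line spanned by `d`. -/
lemma linearIsometryEquiv_eq_reflection (L : Plane ≃ₗᵢ[ℝ] Plane) {d : Plane} (hd : d ≠ 0)
    (hL : L d = d) (hne : ∃ y, L y ≠ y) (y : Plane) :
    (d 0 ^ 2 + d 1 ^ 2) • L y = (2 * (y 0 * d 0 + y 1 * d 1)) • d - (d 0 ^ 2 + d 1 ^ 2) • y := by
  have hN := Plane.sq_add_sq_ne_zero hd
  set e : Plane := !₂[-d 1, d 0] with he
  have he0 : e 0 = -d 1 := by simp [he]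
  have he1 : e 1 = d 0 := by simp [he]
  have hnorm : ∀ z : Plane, (L z) 0 ^ 2 + (L z) 1 ^ 2 = z 0 ^ 2 + z 1 ^ 2 := fun z => by
    have h1 := dist_sq_eq (L z) (L 0)
    have h2 := dist_sq_eq z 0
    rw [L.dist_map] at h1
    rw [h1] at h2
    simpa using h2
  have hsum := hnorm (d + e)
  have hse := hnorm e
  rw [map_add, hL] at hsum
  simp only [PiLp.add_apply, he0, he1] at hsum hse
  have horth : (L e) 0 * d 0 + (L e) 1 * d 1 = 0 := by linarith
  have hdecomp : ∀ z : Plane, (d 0 ^ 2 + d 1 ^ 2) • z =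
      (z 0 * d 0 + z 1 * d 1) • d + (z 1 * d 0 - z 0 * d 1) • e := fun z => by
    apply Plane.ext <;> simp [he0, he1] <;> ring
  have hle := hdecomp (L e)
  rw [horth, zero_smul, zero_add] at hle
  set c := (L e) 1 * d 0 - (L e) 0 * d 1 with hc
  have hcsq : c ^ 2 = (d 0 ^ 2 + d 1 ^ 2) ^ 2 := by
    rw [hc]
    linear_combination (d 0 ^ 2 + d 1 ^ 2) * hse - ((L e) 0 * d 0 + (L e) 1 * d 1) * horth
  have hLz : ∀ z : Plane, (d 0 ^ 2 + d 1 ^ 2) • L z =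
      (z 0 * d 0 + z 1 * d 1) • d + (z 1 * d 0 - z 0 * d 1) • L e := fun z => by
    rw [← map_smul, hdecomp z, map_add, map_smul, map_smul, hL]
  -- Up to the factor `d 0 ^ 2 + d 1 ^ 2`, `c` is the scalar by which `L` acts on the normal `e`.
  -- The positive sign would make `L` the identity.
  rcases sq_eq_sq_iff_eq_or_eq_neg.1 hcsq with h | h
  · exfalso
    rw [h] at hle
    have hLe : L e = e := smul_right_injective _ hN hle
    obtain ⟨z, hz⟩ := hne
    apply hz
    apply smul_right_injective _ hN
    change (d 0 ^ 2 + d 1 ^ 2) • L z = (d 0 ^ 2 + d 1 ^ 2) • z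
    rw [hLz, hLe, ← hdecomp]
  · rw [h, neg_smul, ← smul_neg] at hle
    have hLe : L e = -e := smul_right_injective _ hN hle
    rw [hLz, hLe, hdecomp y]
    module

/-- The formula at the standard basis gives the matrix entries up to the factor `d 0 ^ 2 + d 1 ^ 2`;
the determinant is compared after multiplication by its square. -/
lemma det_of_eq_reflection (L : Plane →ₗ[ℝ] Plane) {d : Plane} (hd : d ≠ 0)
    (h : ∀ y, (d 0 ^ 2 + d 1 ^ 2) • L y =
      (2 * (y 0 * d 0 + y 1 * d 1)) • d - (d 0 ^ 2 + d 1 ^ 2) • y) : LinearMap.det L = -1 := by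
  have hN := Plane.sq_add_sq_ne_zero hd
  rw [← LinearMap.det_toMatrix (EuclideanSpace.basisFun (Fin 2) ℝ).toBasis, Matrix.det_fin_two]
  have h0 := h (EuclideanSpace.single 0 1)
  have h1 := h (EuclideanSpace.single 1 1)
  have h00 := congrArg (fun x : Plane => x 0) h0
  have h01 := congrArg (fun x : Plane => x 1) h0
  have h10 := congrArg (fun x : Plane => x 0) h1
  have h11 := congrArg (fun x : Plane => x 1) h1
  simp at h00 h01 h10 h11
  simp [LinearMap.toMatrix_apply]
  set p := d 0
  set q := d 1
  apply mul_left_cancel₀ (pow_ne_zero 2 hN)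
  linear_combination (p ^ 2 + q ^ 2) * L (EuclideanSpace.single 1 1) 1 * h00 +
    (2 * p * p - (p ^ 2 + q ^ 2)) * h11 -
    (p ^ 2 + q ^ 2) * L (EuclideanSpace.single 0 1) 1 * h10 - (2 * q * p) * h01

/-- The reflection in ray `k` permutes the eight rays; lengths match because `k + m` and `k - m`
have the same parity. -/
lemma rayDir_reflection (k m : ZMod 8) :
    ((rayDir k).1 ^ 2 + (rayDir k).2 ^ 2) • rayDir (k - m) =
      (2 * ((rayDir (k + m)).1 * (rayDir k).1 + (rayDir (k + m)).2 * (rayDir k).2)) • rayDir k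
        - ((rayDir k).1 ^ 2 + (rayDir k).2 ^ 2) • rayDir (k + m) := by
  revert k m; decide

lemma rayVec_reflection (L : Plane ≃ₗᵢ[ℝ] Plane) {k : ZMod 8} (hL : L (rayVec k) = rayVec k)
    (hne : ∃ y, L y ≠ y) (m : ZMod 8) : L (rayVec (k + m)) = rayVec (k - m) := by
  have h := linearIsometryEquiv_eq_reflection L (rayVec_ne_zero k) hL hne (rayVec (k + m))
  have hN := Plane.sq_add_sq_ne_zero (rayVec_ne_zero k)
  apply smul_right_injective _ hN
  change (rayVec k 0 ^ 2 + rayVec k 1 ^ 2) • L (rayVec (k + m)) =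
    (rayVec k 0 ^ 2 + rayVec k 1 ^ 2) • rayVec (k - m)
  rw [h]
  have hr := rayDir_reflection k m
  have h1 := congrArg (fun x : ℤ × ℤ => (x.1 : ℝ)) hr
  have h2 := congrArg (fun x : ℤ × ℤ => (x.2 : ℝ)) hr
  simp at h1 h2
  apply Plane.ext
  · simp
    linear_combination -h1 / 8
  · simp
    linear_combination -h2 / 8

lemma det_linearIsometryEquiv (L : Plane ≃ₗᵢ[ℝ] Plane) :
    LinearMap.det (L.toLinearEquiv : Plane →ₗ[ℝ] Plane) = 1 ∨
      LinearMap.det (L.toLinearEquiv : Plane →ₗ[ℝ] Plane) = -1 := by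
  have h := L.toLinearIsometry.normDet_eq_one
  rw [LinearMap.normDet_eq_abs_det] at h
  exact (abs_eq zero_le_one).1 h

/-! ### Sides -/

/-- Two points in the closure of a convex polyform and in the closure of a disjoint convex open set
lie on a common side of the polyform. -/
lemma Polyform.exists_isSide {P : Polyform} (hP : P.IsConvex) {U : Set Plane} (hU : IsOpen U)
    (hUc : Convex ℝ U) (hd : Disjoint P.region U) {x y : Plane} (hxy : x ≠ y)
    (hx : x ∈ closure P.region) (hy : y ∈ closure P.region) (hx' : x ∈ closure U)
    (hy' : y ∈ closure U) : ∃ e, P.IsSide e ∧ x ∈ e ∧ y ∈ e := by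
  have hopen : IsOpen P.region := isOpen_interior
  -- Points in both closures lie on the separating line `f = u`. This line supports the polyform, so
  -- it cuts out an exposed face containing `x` and `y`.
  obtain ⟨f, u, h1, h2⟩ := geometric_hahn_banach_open_open hP hopen hUc hU hd
  have h1' : ∀ z ∈ closure P.region, f z ≤ u :=
    closure_minimal (fun z hz => (h1 z hz).le) (isClosed_le f.continuous continuous_const)
  have h2' : ∀ z ∈ closure U, u ≤ f z :=
    closure_minimal (fun z hz => (h2 z hz).le) (isClosed_le continuous_const f.continuous)
  have hfx : f x = u := le_antisymm (h1' x hx) (h2' x hx')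
  have hfy : f y = u := le_antisymm (h1' y hy) (h2' y hy')
  refine ⟨{z | z ∈ closure P.region ∧ f z = u}, ⟨?_, ?_, ?_⟩, ⟨hx, hfx⟩, ⟨hy, hfy⟩⟩
  · intro _
    refine ⟨f, Set.ext fun z => ⟨?_, ?_⟩⟩
    · rintro ⟨hz, hfz⟩
      exact ⟨hz, fun w hw => hfz ▸ h1' w hw⟩
    · rintro ⟨hz, hfz⟩
      exact ⟨hz, le_antisymm (h1' z hz) (hfx ▸ hfz x hx)⟩
  · rintro z ⟨hz, hfz⟩
    refine ⟨hz, fun hzi => ?_⟩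
    rw [hopen.interior_eq] at hzi
    exact (h1 z hzi).ne hfz
  · exact ⟨x, ⟨hx, hfx⟩, y, ⟨hy, hfy⟩, hxy⟩

/-! ### Tiles and their common sides. -/

namespace DCTiling

variable {P₁ P₂ : Polyform} {D : DCStructure P₁} (T : DCTiling D P₂)

/-- The triangles of the `i`-th tile. -/
def tileTriangles (i : Fin T.n) : Set (Set Plane) :=
  (fun m : Set Plane => T.place i '' m) '' P₁.triangles

lemma tileTriangles_subset (i : Fin T.n) : T.tileTriangles i ⊆ triangleTiling := by
  rintro _ ⟨m, hm, rfl⟩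
  exact (T.isTilingAut i).image_mem (P₁.subset_tiling hm)

lemma mem_triangles_iff {m : Set Plane} : m ∈ P₂.triangles ↔ ∃ i, m ∈ T.tileTriangles i := by
  rw [← T.cover, Set.mem_iUnion]
  rfl

lemma tile_unique {m : Set Plane} {i j : Fin T.n} (hi : m ∈ T.tileTriangles i)
    (hj : m ∈ T.tileTriangles j) : i = j := by
  by_contra h
  exact Set.disjoint_left.1 (T.disjoint i j h) hi hj

lemma image_region (i : Fin T.n) :
    T.place i '' P₁.region = enclosedRegion (T.tileTriangles i) := by
  have h := (T.place i).toHomeomorph.image_interior (⋃₀ P₁.triangles)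
  rw [AffineIsometryEquiv.coe_toHomeomorph, Set.sUnion_eq_biUnion, Set.image_iUnion₂] at h
  rw [enclosedRegion, tileTriangles, Set.sUnion_image, ← h, ← Set.sUnion_eq_biUnion]
  rfl

lemma mem_tileDomain_iff {i : Fin T.n} {v : ℤ × ℤ} :
    v ∈ T.tileDomain i ↔ ∀ k, sector v k ∈ T.tileTriangles i := by
  rw [tileDomain, Set.mem_ofPred_eq, image_region,
    latticePoint_mem_enclosedRegion_iff (T.tileTriangles_subset i)]

lemma tileDomain_subset (i : Fin T.n) : T.tileDomain i ⊆ P₂.domain := fun _ hv =>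
  P₂.mem_domain_iff.2 fun k => T.mem_triangles_iff.2 ⟨i, T.mem_tileDomain_iff.1 hv k⟩

lemma mem_tileDomain_iff_latticePerm_symm {i : Fin T.n} {v : ℤ × ℤ} :
    v ∈ T.tileDomain i ↔ (T.isTilingAut i).latticePerm.symm v ∈ P₁.domain := by
  rw [tileDomain, Polyform.domain, Set.mem_ofPred_eq, Set.mem_ofPred_eq,
    IsTilingAut.latticePoint_latticePerm_symm]
  constructor
  · rintro ⟨x, hx, h⟩
    rwa [← h, AffineIsometryEquiv.symm_apply_apply]
  · intro h
    exact ⟨_, h, AffineIsometryEquiv.apply_symm_apply _ _⟩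

lemma convex_enclosedRegion (hP₁ : P₁.IsConvex) (i : Fin T.n) :
    Convex ℝ (enclosedRegion (T.tileTriangles i)) := by
  rw [← image_region]
  exact hP₁.affine_image (T.place i).toAffineEquiv.toAffineMap

lemma mem_closure_region {i : Fin T.n} {x : Plane} {v : ℤ × ℤ} {k : ZMod 8}
    (h : sector v k ∈ T.tileTriangles i) (hx : x ∈ sector v k) :
    (T.place i).symm x ∈ closure P₁.region := by
  have h1 : x ∈ closure (enclosedRegion (T.tileTriangles i)) :=
    closure_mono (openSector_subset_enclosedRegion h) (sector_subset_closure_openSector v k hx)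
  have h2 := (T.place i).toHomeomorph.image_closure P₁.region
  rw [AffineIsometryEquiv.coe_toHomeomorph] at h2
  rw [← image_region, ← h2] at h1
  obtain ⟨y, hy, rfl⟩ := h1
  rwa [AffineIsometryEquiv.symm_apply_apply]

/-- Two common points of a triangle of the `i`-th tile and a triangle outside the tile lie on a
side of the tile. -/
lemma exists_isSide (hP₁ : P₁.IsConvex) {i : Fin T.n} {v : ℤ × ℤ} {k l : ZMod 8}
    (hk : sector v k ∈ T.tileTriangles i) (hl : sector v l ∉ T.tileTriangles i) {x y : Plane}
    (hxy : x ≠ y) (hxk : x ∈ sector v k) (hyk : y ∈ sector v k) (hxl : x ∈ sector v l)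
    (hyl : y ∈ sector v l) :
    ∃ e, P₁.IsSide e ∧ x ∈ T.place i '' e ∧ y ∈ T.place i '' e := by
  have hcl : ∀ z ∈ sector v l, (T.place i).symm z ∈
      closure ((T.place i).symm '' openSector v l) := fun z hz => by
    have h2 := (T.place i).symm.toHomeomorph.image_closure (openSector v l)
    rw [AffineIsometryEquiv.coe_toHomeomorph] at h2
    rw [← h2]
    exact Set.mem_image_of_mem _ (sector_subset_closure_openSector v l hz)
  obtain ⟨e, he, hxe, hye⟩ := Polyform.exists_isSide hP₁
    (U := (T.place i).symm '' openSector v l)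
    ((T.place i).symm.toHomeomorph.isOpenMap _ (isOpen_openSector v l))
    ((convex_openSector v l).affine_image (T.place i).symm.toAffineEquiv.toAffineMap)
    (by
      rw [Set.disjoint_left]
      rintro _ hz ⟨w, hw, rfl⟩
      refine hl (sector_mem_of_mem_enclosedRegion (T.tileTriangles_subset i) hw ?_)
      rw [← image_region]
      exact ⟨_, hz, AffineIsometryEquiv.apply_symm_apply _ _⟩)
    ((T.place i).symm.injective.ne hxy) (T.mem_closure_region hk hxk)
    (T.mem_closure_region hk hyk) (hcl x hxl) (hcl y hyl)
  exact ⟨e, he, ⟨_, hxe, AffineIsometryEquiv.apply_symm_apply _ _⟩,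
    ⟨_, hye, AffineIsometryEquiv.apply_symm_apply _ _⟩⟩

/-- Tiles that meet along a ray are exchanged by an isometry that fixes the ray. -/
lemma exists_isometry_of_adjacent (hP₁ : P₁.IsConvex) {i j : Fin T.n} (hij : i ≠ j) {v : ℤ × ℤ}
    {k : ZMod 8} (hi : sector v k ∈ T.tileTriangles i)
    (hj : sector v (k + 1) ∈ T.tileTriangles j) :
    ∃ R : Plane ≃ᵃⁱ[ℝ] Plane, (∀ x, R (T.place i x) = T.place j x) ∧
      R (latticePoint v) = latticePoint v ∧
      R (latticePoint v + rayVec (k + 1)) = latticePoint v + rayVec (k + 1) := by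
  set x := latticePoint v
  set y := latticePoint v + rayVec (k + 1)
  have hxy : x ≠ y := by
    intro h
    exact rayVec_ne_zero (k + 1) (left_eq_add.1 h)
  obtain ⟨e, he, hxe, hye⟩ := T.exists_isSide hP₁ hi (fun h => hij (T.tile_unique h hj)) hxy
    (latticePoint_mem_sector _ _) (add_rayVec_succ_mem_sector _ _) (latticePoint_mem_sector _ _)
    (add_rayVec_mem_sector _ _)
  obtain ⟨e', he', hxe', hye'⟩ := T.exists_isSide hP₁ hj (fun h => hij (T.tile_unique hi h)) hxy
    (latticePoint_mem_sector _ _) (add_rayVec_mem_sector _ _) (latticePoint_mem_sector _ _)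
    (add_rayVec_succ_mem_sector _ _)
  obtain ⟨-, hcol, htail, hhead⟩ := T.matching i j hij e e' he he'
    ⟨x, ⟨hxe, hxe'⟩, y, ⟨hye, hye'⟩, hxy⟩
  -- Equal colours mean that both tiles show the same side of `P₁`. Equal directions then make the
  -- two placements agree at its ends, hence on the whole side.
  obtain rfl := D.color_injOn he he' hcol
  have hagree : ∀ z ∈ e, T.place j z = T.place i z := by
    intro z hz
    rw [← D.segment_eq e he] at hz
    obtain ⟨s, t, -, -, hst, rfl⟩ := hz
    obtain rfl : s = 1 - t := by linarith
    have hline : ∀ l, T.place l (AffineMap.lineMap (D.tail e) (D.head e) t) =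
        AffineMap.lineMap (T.place l (D.tail e)) (T.place l (D.head e)) t :=
      fun l => (T.place l).toAffineEquiv.toAffineMap.apply_lineMap _ _ _
    rw [← AffineMap.lineMap_apply_module, hline, hline, htail, hhead]
  refine ⟨(T.place i).symm.trans (T.place j), fun z => by simp, ?_, ?_⟩
  · obtain ⟨z, hz, h⟩ := hxe
    rw [← h]
    simpa using hagree z hz
  · obtain ⟨z, hz, h⟩ := hye
    rw [← h]
    simpa using hagree z hz

/-- Tiles that meet along a ray are reflections of each other in the line of the ray. -/
lemma exists_reflection_of_adjacent (hP₁ : P₁.IsConvex) {i j : Fin T.n} (hij : i ≠ j) {v : ℤ × ℤ}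
    {k : ZMod 8} (hi : sector v k ∈ T.tileTriangles i)
    (hj : sector v (k + 1) ∈ T.tileTriangles j) :
    ∃ R : Plane ≃ᵃⁱ[ℝ] Plane, (∀ x, R (T.place i x) = T.place j x) ∧
      R (latticePoint v) = latticePoint v ∧
      (∀ m, R (latticePoint v + rayVec (k + 1 + m)) = latticePoint v + rayVec (k + 1 - m)) ∧
      T.sign j = -T.sign i := by
  obtain ⟨R, hR, hv, hray⟩ := T.exists_isometry_of_adjacent hP₁ hij hi hj
  have hadd := affineIsometryEquiv_apply_add R hv
  have hL : R.linearIsometryEquiv (rayVec (k + 1)) = rayVec (k + 1) := by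
    rw [hadd] at hray
    exact add_left_cancel hray
  -- If the linear part were the identity, the two tiles would have the same triangles, against
  -- disjointness.
  have hne : ∃ y, R.linearIsometryEquiv y ≠ y := by
    by_contra! hid
    have hRid : ∀ x, R x = x := fun x => by
      have := hadd (x - latticePoint v)
      rwa [hid, add_sub_cancel] at this
    have hplace : ⇑(T.place j) = T.place i := funext fun x => by rw [← hR, hRid]
    have : T.tileTriangles j = T.tileTriangles i := by
      rw [tileTriangles, tileTriangles, hplace]
    exact hij (T.tile_unique hi (this ▸ hi))
  refine ⟨R, hR, hv, fun m => by rw [hadd, rayVec_reflection _ hL hne], ?_⟩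
  have hdetR : LinearMap.det (R.linearIsometryEquiv.toLinearEquiv : Plane →ₗ[ℝ] Plane) = -1 :=
    det_of_eq_reflection _ (rayVec_ne_zero (k + 1))
      (linearIsometryEquiv_eq_reflection _ (rayVec_ne_zero _) hL hne)
  have hcomp : T.place j = (T.place i).trans R := by
    ext1 x
    exact (hR x).symm
  have hdet : LinearMap.det ((T.place j).linearIsometryEquiv.toLinearEquiv : Plane →ₗ[ℝ] Plane) =
      -LinearMap.det ((T.place i).linearIsometryEquiv.toLinearEquiv : Plane →ₗ[ℝ] Plane) := by
    rw [hcomp, show (((T.place i).trans R).linearIsometryEquiv.toLinearEquiv : Plane →ₗ[ℝ] Plane) =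
      (R.linearIsometryEquiv.toLinearEquiv : Plane →ₗ[ℝ] Plane) ∘ₗ
      ((T.place i).linearIsometryEquiv.toLinearEquiv : Plane →ₗ[ℝ] Plane) from rfl,
      LinearMap.det_comp, hdetR, neg_one_mul]
  rw [sign, sign, hdet]
  rcases det_linearIsometryEquiv (T.place i).linearIsometryEquiv with h | h <;> rw [h] <;> norm_num

/-! ### The reflected extension -/

/-- The part of the reflected extension of `H` on the `i`-th tile, extended by zero. -/
noncomputable def tileValue (H : P₁.domain → ℚ) (i : Fin T.n) (w : ℤ × ℤ) : ℚ :=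
  T.sign i * extendZero H ((T.isTilingAut i).latticePerm.symm w)

lemma tileValue_of_notMem (H : P₁.domain → ℚ) {i : Fin T.n} {w : ℤ × ℤ}
    (h : w ∉ T.tileDomain i) : T.tileValue H i w = 0 := by
  rw [tileValue, extendZero_of_notMem, mul_zero]
  rwa [← mem_tileDomain_iff_latticePerm_symm]

/-- This replaces the chosen preimages in the definition by the lattice permutations of the tiles.
-/
lemma reflect_eq_sum_tileValue (H : P₁.domain → ℚ) (w : P₂.domain) :
    T.reflect H w = ∑ i, T.tileValue H i w := by
  refine Finset.sum_congr rfl fun i _ => ?_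
  split_ifs with h
  · have hspec := h.choose_spec
    rw [← (T.isTilingAut i).latticePoint_latticePerm] at hspec
    have hw : (T.isTilingAut i).latticePerm.symm w = h.choose :=
      (Equiv.symm_apply_eq _).2 (latticePoint_injective hspec).symm
    rw [tileValue, hw, extendZero_coe]
  · rw [tileValue_of_notMem]
    rw [mem_tileDomain_iff_latticePerm_symm]
    intro hw
    exact h ⟨⟨_, hw⟩, by
      rw [← (T.isTilingAut i).latticePoint_latticePerm, Equiv.apply_symm_apply]⟩

lemma extendZero_reflect (H : P₁.domain → ℚ) (w : ℤ × ℤ) :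
    extendZero (T.reflect H) w = ∑ i, T.tileValue H i w := by
  by_cases hw : w ∈ P₂.domain
  · rw [extendZero_of_mem _ hw, reflect_eq_sum_tileValue]
  · rw [extendZero_of_notMem _ hw]
    exact (Finset.sum_eq_zero fun i _ =>
      T.tileValue_of_notMem H fun h => hw (T.tileDomain_subset i h)).symm

/-- A single triangle at `w` suffices: a tile enclosing `w` contains all triangles at `w`, so it can
only be the `i`-th. If no tile encloses `w`, both sides are zero. -/
lemma extendZero_reflect_of_sector_mem (H : P₁.domain → ℚ) {w : ℤ × ℤ} {k : ZMod 8}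
    {i : Fin T.n} (h : sector w k ∈ T.tileTriangles i) :
    extendZero (T.reflect H) w = T.tileValue H i w := by
  rw [extendZero_reflect]
  refine Finset.sum_eq_single i (fun j _ hj => T.tileValue_of_notMem H fun hw => ?_) (by simp)
  exact hj (T.tile_unique (T.mem_tileDomain_iff.1 hw k) h)

lemma tileDomain_unique {i j : Fin T.n} {v : ℤ × ℤ} (hi : v ∈ T.tileDomain i)
    (hj : v ∈ T.tileDomain j) : i = j :=
  T.tile_unique (T.mem_tileDomain_iff.1 hi 0) (T.mem_tileDomain_iff.1 hj 0)

/-- A neighbour of a vertex of the `i`-th tile is a corner of a triangle of this tile. -/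
lemma exists_sector_mem_of_neighbor {i : Fin T.n} {v w : ℤ × ℤ} (hv : v ∈ T.tileDomain i)
    (hw : w ∈ latticeNeighbors v) : ∃ k, sector w k ∈ T.tileTriangles i := by
  have key : ∀ k : ZMod 8, 4 * k = 0 → v + axisStep k = w →
      ∃ k, sector w k ∈ T.tileTriangles i := by
    rintro k hk rfl
    exact ⟨_, sector_eq_sector_left hk v ▸ T.mem_tileDomain_iff.1 hv k⟩
  simp only [latticeNeighbors, Finset.mem_insert, Finset.mem_singleton] at hw
  have h0 : axisStep 0 = (1, 0) := rfl
  have h2 : axisStep 2 = (0, 1) := rfl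
  have h4 : axisStep 4 = (-1, 0) := rfl
  have h6 : axisStep 6 = (0, -1) := rfl
  rcases hw with rfl | rfl | rfl | rfl
  · exact key 0 rfl (by rw [h0]; ext <;> simp)
  · exact key 4 rfl (by rw [h4]; ext <;> simp [sub_eq_add_neg])
  · exact key 2 rfl (by rw [h2]; ext <;> simp)
  · exact key 6 rfl (by rw [h6]; ext <;> simp [sub_eq_add_neg])

/-- Adjacent vertices share a triangle, so vertices enclosed by different tiles are never
neighbours. -/
lemma mem_internalBoundary_of_neighbor {i : Fin T.n} {v w : ℤ × ℤ} (hv : v ∈ T.tileDomain i)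
    (hw : w ∈ latticeNeighbors v) (hwi : w ∉ T.tileDomain i) (hw2 : w ∈ P₂.domain) :
    w ∈ T.internalBoundary := by
  refine ⟨hw2, fun h => ?_⟩
  obtain ⟨j, hj⟩ := Set.mem_iUnion.1 h
  obtain ⟨k, hk⟩ := T.exists_sector_mem_of_neighbor hv hw
  obtain rfl := T.tile_unique hk (T.mem_tileDomain_iff.1 hj k)
  exact hwi hj

/-- On a tile the Laplacian of the reflected extension is the transported one. -/
lemma reducedLaplacian_reflect_of_mem (H : P₁.domain → ℚ) {i : Fin T.n} (v : P₂.domain)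
    (hv : (v : ℤ × ℤ) ∈ T.tileDomain i) :
    reducedLaplacian P₂.domain ℚ (T.reflect H) v = T.sign i * reducedLaplacian P₁.domain ℚ H
      ⟨(T.isTilingAut i).latticePerm.symm v, T.mem_tileDomain_iff_latticePerm_symm.1 hv⟩ := by
  rw [reducedLaplacian_apply, reducedLaplacian_apply, ← extendZero_coe (T.reflect H) v,
    T.extendZero_reflect_of_sector_mem H (T.mem_tileDomain_iff.1 hv 0), tileValue,
    extendZero_of_mem H (T.mem_tileDomain_iff_latticePerm_symm.1 hv),
    ← IsTilingAut.sum_latticeNeighbors_latticePerm_symm, mul_sub, Finset.mul_sum]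
  congr 1
  · refine Finset.sum_congr rfl fun w hw => ?_
    obtain ⟨k, hk⟩ := T.exists_sector_mem_of_neighbor hv hw
    exact T.extendZero_reflect_of_sector_mem H hk
  · ring

/-- Since `R` carries one placement to the other, `w` and `w'` pull back to the same lattice vertex,
and only the signs differ. -/
lemma extendZero_reflect_of_reflection (H : P₁.domain → ℚ) {i j : Fin T.n}
    {R : Plane ≃ᵃⁱ[ℝ] Plane} (hR : ∀ x, R (T.place i x) = T.place j x)
    (hs : T.sign j = -T.sign i) {w w' : ℤ × ℤ} (hw : R (latticePoint w') = latticePoint w)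
    {k k' : ZMod 8} (hk : sector w k ∈ T.tileTriangles j)
    (hk' : sector w' k' ∈ T.tileTriangles i) :
    extendZero (T.reflect H) w = -extendZero (T.reflect H) w' := by
  rw [T.extendZero_reflect_of_sector_mem H hk, T.extendZero_reflect_of_sector_mem H hk', tileValue,
    tileValue, hs, neg_mul]
  congr 3
  apply latticePoint_injective
  rw [IsTilingAut.latticePoint_latticePerm_symm, IsTilingAut.latticePoint_latticePerm_symm, ← hw]
  apply (T.place j).injective
  rw [AffineIsometryEquiv.apply_symm_apply, ← hR, AffineIsometryEquiv.apply_symm_apply]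

/-- A reflection reverses the cyclic order: the rays `k + 1 + m` and `k + 2 + m` go to `k + 1 - m`
and `k - m`, and the latter pair bounds sector `k - m`. -/
lemma image_sector {R : Plane ≃ᵃⁱ[ℝ] Plane} {v : ℤ × ℤ} {k : ZMod 8}
    (hv : R (latticePoint v) = latticePoint v)
    (hray : ∀ m, R (latticePoint v + rayVec (k + 1 + m)) = latticePoint v + rayVec (k + 1 - m))
    (m : ZMod 8) : R '' sector v (k + 1 + m) = sector v (k - m) := by
  have h : R '' sector v (k + 1 + m) = convexHull ℝ (R '' {latticePoint v,
      latticePoint v + rayVec (k + 1 + m), latticePoint v + rayVec (k + 1 + m + 1)}) :=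
    R.toAffineEquiv.toAffineMap.image_convexHull _
  rw [h, Set.image_insert_eq, Set.image_pair, hv, hray, add_assoc (k + 1) m 1, hray, sector,
    closedTriangle_comm₂₃, closedTriangle]
  congr 6 <;> ring

lemma image_mem_tileTriangles_iff {i j : Fin T.n} {R : Plane ≃ᵃⁱ[ℝ] Plane}
    (hR : ∀ x, R (T.place i x) = T.place j x) {m : Set Plane} :
    R '' m ∈ T.tileTriangles j ↔ m ∈ T.tileTriangles i := by
  have : T.tileTriangles j = (fun m : Set Plane => R '' m) '' T.tileTriangles i := by
    rw [tileTriangles, tileTriangles, Set.image_image]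
    refine Set.image_congr fun m _ => ?_
    rw [Set.image_image]
    exact Set.image_congr fun x _ => (hR x).symm
  rw [this]
  exact (Set.image_injective.2 R.injective).mem_set_image

end DCTiling

/-! ### Harmonicity of the reflected extension at internal boundaries. -/

/-- Zero terms on the diagonal rays put the neighbour sum on all of `ZMod 8`, so that reflections in
diagonal sides are treated like the others. -/
lemma sum_latticeNeighbors_eq_sum_axisStep {R : Type*} [AddCommMonoid R] (F : ℤ × ℤ → R)
    (v : ℤ × ℤ) : ∑ w ∈ latticeNeighbors v, F w =
      ∑ k : ZMod 8, if 4 * k = 0 then F (v + axisStep k) else 0 := by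
  rw [sum_latticeNeighbors]
  have h : (∑ k : ZMod 8, if 4 * k = 0 then F (v + axisStep k) else 0) =
      F (v + (1, 0)) + 0 + F (v + (0, 1)) + 0 + F (v + (-1, 0)) + 0 + F (v + (0, -1)) + 0 :=
    sum_zmod_eight _
  rw [h]
  obtain ⟨x, y⟩ := v
  simp only [Prod.mk_add_mk, add_zero, sub_eq_add_neg]
  abel

namespace DCTiling

variable {P₁ P₂ : Polyform} {D : DCStructure P₁} (T : DCTiling D P₂)

/-- The eight sectors at `v` are labelled by their tiles. Convexity excludes opposite sectors in one
tile, as that tile would enclose `v`. Adjacent tiles are signed mirror images, so the neighbour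
values cancel. -/
lemma reducedLaplacian_reflect_of_mem_internalBoundary (hP₁ : P₁.IsConvex) (H : P₁.domain → ℚ)
    (v : P₂.domain) (hv : (v : ℤ × ℤ) ∈ T.internalBoundary) :
    reducedLaplacian P₂.domain ℚ (T.reflect H) v = 0 := by
  have hnot : ∀ i, (v : ℤ × ℤ) ∉ T.tileDomain i := fun i hi =>
    hv.2 (Set.mem_iUnion.2 ⟨i, hi⟩)
  have h0 : T.reflect H v = 0 := by
    rw [reflect_eq_sum_tileValue]
    exact Finset.sum_eq_zero fun i _ => T.tileValue_of_notMem H (hnot i)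
  rw [reducedLaplacian_apply, h0, mul_zero, sub_zero, sum_latticeNeighbors_eq_sum_axisStep]
  obtain ⟨v, hv2⟩ := v
  have ht : ∀ k, ∃ i, sector v k ∈ T.tileTriangles i := fun k =>
    T.mem_triangles_iff.1 (P₂.mem_domain_iff.1 hv2 k)
  choose t ht using ht
  have hmem : ∀ k i, sector v k ∈ T.tileTriangles i ↔ t k = i := fun k i =>
    ⟨fun h => T.tile_unique (ht k) h, fun h => h ▸ ht k⟩
  have htile : ∀ k, t k ≠ t (k + 1) → ∀ m, t (k + 1 + m) = t (k + 1) ↔ t (k - m) = t k := by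
    intro k hk m
    obtain ⟨R, hR, hRv, hray, -⟩ := T.exists_reflection_of_adjacent hP₁ hk (ht k) (ht (k + 1))
    rw [← hmem, ← hmem, ← T.image_mem_tileTriangles_iff hR]
    have := image_sector hRv hray (-m - 1)
    rw [show k + 1 + (-m - 1) = k - m by ring, show k - (-m - 1) = k + 1 + m by ring] at this
    rw [this]
  have haxis : ∀ k m : ZMod 8, 4 * (k + 1 + m) = 0 ↔ 4 * (k + 1 - m) = 0 := by decide
  refine sum_eq_zero_of_reflections t _ ?_ htile ?_ ?_
  · intro k hk
    have hk' := (hmem (k + 4) (t k)).2 hk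
    refine hnot (t k) (T.mem_tileDomain_iff.2 ?_)
    exact (latticePoint_mem_enclosedRegion_iff (T.tileTriangles_subset _)).1
      (latticePoint_mem_of_opposite_sectors (T.convex_enclosedRegion hP₁ _) (ht k) hk')
  · intro k hk m hm
    obtain ⟨R, hR, hRv, hray, hs⟩ := T.exists_reflection_of_adjacent hP₁ hk (ht k) (ht (k + 1))
    by_cases h : 4 * (k + 1 + m) = 0
    · have h' := (haxis k m).1 h
      rw [if_pos h, if_pos h']
      have hj := (hmem _ _).2 hm
      have hi := (hmem _ _).2 ((htile k hk m).1 hm)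
      -- The sector beside the ray is also a triangle at the neighbour where the ray ends, so it
      -- tells which tile to evaluate there. Its mirror image lies on the other side of the mirrored
      -- ray.
      rw [sector_eq_sector_left h] at hj
      rw [sector_eq_sector_right (by rwa [show k - m + 1 = k + 1 - m by ring]),
        show k - m + 1 = k + 1 - m by ring] at hi
      refine T.extendZero_reflect_of_reflection H hR hs ?_ hj hi
      rw [← latticePoint_add_rayVec h, ← latticePoint_add_rayVec h']
      have := hray (-m)
      rwa [← sub_eq_add_neg, sub_neg_eq_add] at this
    · rw [if_neg h, if_neg (fun h' => h ((haxis k m).2 h')), neg_zero]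
  · intro k hk m hm
    obtain ⟨R, hR, hRv, hray, hs⟩ := T.exists_reflection_of_adjacent hP₁ hk (ht k) (ht (k + 1))
    by_cases h : 4 * (k + 1 + m) = 0
    · have h' := (haxis k m).1 h
      rw [if_pos h, if_pos h']
      have hj := (hmem _ _).2 hm
      -- The sector to the right of ray `k + 1 + m` has index `k + m`, hence the shift to `m - 1`.
      have hi := (hmem _ _).2 ((htile k hk (m - 1)).1
        (by rwa [show k + 1 + (m - 1) = k + m by ring]))
      rw [show k - (m - 1) = k + 1 - m by ring, sector_eq_sector_left h'] at hi
      rw [sector_eq_sector_right (by rwa [show k + m + 1 = k + 1 + m by ring]),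
        show k + m + 1 = k + 1 + m by ring] at hj
      refine T.extendZero_reflect_of_reflection H hR hs ?_ hj hi
      rw [← latticePoint_add_rayVec h, ← latticePoint_add_rayVec h']
      have := hray (-m)
      rwa [← sub_eq_add_neg, sub_neg_eq_add] at this
    · rw [if_neg h, if_neg (fun h' => h ((haxis k m).2 h')), neg_zero]

/-! ### The corrected extension and its class. -/

lemma mem_tileDomain_or_mem_internalBoundary (v : P₂.domain) :
    (∃ i, (v : ℤ × ℤ) ∈ T.tileDomain i) ∨ (v : ℤ × ℤ) ∈ T.internalBoundary := by
  by_cases h : ∃ i, (v : ℤ × ℤ) ∈ T.tileDomain i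
  · exact Or.inl h
  · exact Or.inr ⟨v.2, fun h' => h (Set.mem_iUnion.1 h')⟩

lemma sign_eq_one_or (i : Fin T.n) : T.sign i = 1 ∨ T.sign i = -1 := by
  unfold sign
  split_ifs <;> simp

lemma exists_intCast_reducedLaplacian_reflect (hP₁ : P₁.IsConvex) {H : P₁.domain → ℚ}
    {c : SandpileGroup P₁.domain} (hH : HarmonicRepresents H c) (v : P₂.domain) :
    ∃ z : ℤ, (z : ℚ) = -reducedLaplacian P₂.domain ℚ (T.reflect H) v := by
  rcases T.mem_tileDomain_or_mem_internalBoundary v with ⟨i, hi⟩ | hv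
  · obtain ⟨-, X, hX, -⟩ := hH
    rw [T.reducedLaplacian_reflect_of_mem H v hi, ← mul_neg, ← hX]
    rcases T.sign_eq_one_or i with h | h <;> rw [h]
    · exact ⟨_, (one_mul _).symm⟩
    · exact ⟨-X ⟨_, T.mem_tileDomain_iff_latticePerm_symm.1 hi⟩, by
        rw [neg_one_mul, Int.cast_neg]⟩
  · exact ⟨0, by rw [T.reducedLaplacian_reflect_of_mem_internalBoundary hP₁ H v hv]; simp⟩

lemma exists_isCorrection (hP₁ : P₁.IsConvex) {H : P₁.domain → ℚ}
    {c : SandpileGroup P₁.domain} (hH : HarmonicRepresents H c) :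
    ∃ X : Fin T.n → P₂.domain → ℤ, T.IsCorrection H X := by
  classical
  choose z hz using T.exists_intCast_reducedLaplacian_reflect hP₁ hH
  choose X hX using fun i => exists_reducedLaplacian_eq_of_notMem_boundary P₂.domain
    (fun v => if (v : ℤ × ℤ) ∈ domainBoundary (T.tileDomain i) ∧
      ∃ b ∈ latticeNeighbors v, b ∈ T.internalBoundary then z v else 0)
  refine ⟨X, fun i v hv => ⟨fun h => ?_, fun h => ?_⟩⟩
  · rw [hX i v hv, if_pos h, hz]
  · rw [hX i v hv, if_neg h]

lemma corrected_eq (H : P₁.domain → ℚ) (X : Fin T.n → P₂.domain → ℤ) :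
    T.corrected H X = T.reflect H + fun v => (((∑ i, X i) v : ℤ) : ℚ) := by
  funext v
  simp [corrected, Finset.sum_apply]

/-- A vertex of a tile in the interior of the large domain at which the Laplacian of the reflected
extension does not vanish has a neighbour in an internal boundary. -/
lemma reducedLaplacian_reflect_eq_zero (hP₁ : P₁.IsConvex) {H : P₁.domain → ℚ}
    {c : SandpileGroup P₁.domain} (hH : HarmonicRepresents H c) (v : P₂.domain)
    (hv : (v : ℤ × ℤ) ∉ domainBoundary P₂.domain)
    (h : ∀ i, ¬((v : ℤ × ℤ) ∈ domainBoundary (T.tileDomain i) ∧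
      ∃ b ∈ latticeNeighbors v, b ∈ T.internalBoundary)) :
    reducedLaplacian P₂.domain ℚ (T.reflect H) v = 0 := by
  rcases T.mem_tileDomain_or_mem_internalBoundary v with ⟨i, hi⟩ | hv'
  · have hall : ∀ w ∈ latticeNeighbors (v : ℤ × ℤ), w ∈ T.tileDomain i := by
      intro w hw
      by_contra hwi
      have hw2 : w ∈ P₂.domain := by
        by_contra hw2
        exact hv ⟨v.2, w, hw, hw2⟩
      exact h i ⟨⟨hi, w, hw, hwi⟩, w, hw, T.mem_internalBoundary_of_neighbor hi hw hwi hw2⟩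
    rw [T.reducedLaplacian_reflect_of_mem H v hi, hH.1, mul_zero]
    rintro ⟨-, w, hw, hw1⟩
    apply hw1
    rw [← Equiv.symm_apply_apply (T.isTilingAut i).latticePerm w,
      ← mem_tileDomain_iff_latticePerm_symm]
    apply hall
    rw [← (T.isTilingAut i).latticePerm_symm_mem_latticeNeighbors, Equiv.symm_apply_apply]
    exact hw
  · exact T.reducedLaplacian_reflect_of_mem_internalBoundary hP₁ H v hv'

/-- Tile domains are disjoint, so at a defect exactly one correction acts and cancels it; at the
other non-boundary vertices all terms are harmonic. Integrality survives because the corrections are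
integer-valued. -/
lemma exists_harmonicRepresents_corrected (hP₁ : P₁.IsConvex) {H : P₁.domain → ℚ}
    {c : SandpileGroup P₁.domain} (hH : HarmonicRepresents H c)
    {X : Fin T.n → P₂.domain → ℤ} (hX : T.IsCorrection H X) :
    ∃ d : SandpileGroup P₂.domain, HarmonicRepresents (T.corrected H X) d := by
  choose z hz using T.exists_intCast_reducedLaplacian_reflect hP₁ hH
  refine ⟨_, fun v hv => ?_, fun v => z v - reducedLaplacian P₂.domain ℤ (∑ i, X i) v,
    fun v => ?_, rfl⟩
  · rw [corrected_eq, map_add, Pi.add_apply, reducedLaplacian_intCast, map_sum, Finset.sum_apply,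
      Int.cast_sum]
    by_cases h : ∃ i, (v : ℤ × ℤ) ∈ domainBoundary (T.tileDomain i) ∧
      ∃ b ∈ latticeNeighbors v, b ∈ T.internalBoundary
    · obtain ⟨i, hi⟩ := h
      rw [Finset.sum_eq_single i, (hX i v hv).1 hi, add_neg_cancel]
      · intro j _ hj
        rw [(hX j v hv).2 fun h => hj (T.tileDomain_unique h.1.1 hi.1.1), Int.cast_zero]
      · simp
    · push Not at h
      rw [T.reducedLaplacian_reflect_eq_zero hP₁ hH v hv
        (fun i hi => by obtain ⟨hi1, b, hb, hb'⟩ := hi; exact h i hi1 b hb hb'), zero_add]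
      refine Finset.sum_eq_zero fun i _ => ?_
      rw [(hX i v hv).2 (fun hi => by obtain ⟨hi1, b, hb, hb'⟩ := hi; exact h i hi1 b hb hb'),
        Int.cast_zero]
  · rw [corrected_eq, map_add, Pi.add_apply, reducedLaplacian_intCast, Int.cast_sub, hz]
    ring

lemma nonempty_tiles : Nonempty (Fin T.n) := by
  obtain ⟨m, hm⟩ := P₂.triangles_nonempty
  exact ⟨(T.mem_triangles_iff.1 hm).choose⟩

/-- Any single tile displays all values of `H` up to a common sign, and there is at least one tile.
-/
lemma exists_reflect_eq_intCast_iff (H : P₁.domain → ℚ) :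
    (∃ Y : P₂.domain → ℤ, ∀ v, T.reflect H v = Y v) ↔
      ∃ Y : P₁.domain → ℤ, ∀ v, H v = Y v := by
  constructor
  · rintro ⟨Y, hY⟩
    obtain ⟨i⟩ := T.nonempty_tiles
    have : ∀ v : P₁.domain, ∃ z : ℤ, H v = z := by
      intro v
      set w := (T.isTilingAut i).latticePerm v with hw
      have hsymm : (T.isTilingAut i).latticePerm.symm w = v := Equiv.symm_apply_apply _ _
      have hwi : w ∈ T.tileDomain i := by
        rw [mem_tileDomain_iff_latticePerm_symm, hsymm]
        exact v.2
      have h := T.extendZero_reflect_of_sector_mem H (T.mem_tileDomain_iff.1 hwi 0)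
      rw [extendZero_of_mem _ (T.tileDomain_subset i hwi), hY, tileValue, hsymm,
        extendZero_coe] at h
      rcases T.sign_eq_one_or i with hs | hs
      · exact ⟨_, by rw [h, hs, one_mul]⟩
      · refine ⟨-Y ⟨w, T.tileDomain_subset i hwi⟩, ?_⟩
        rw [Int.cast_neg, h, hs, neg_one_mul, neg_neg]
    choose z hz using this
    exact ⟨z, hz⟩
  · rintro ⟨Y, hY⟩
    obtain rfl : H = fun v => (Y v : ℚ) := funext hY
    refine ⟨fun w => ∑ i, (if T.sign i = 1 then 1 else -1) *
      extendZero Y ((T.isTilingAut i).latticePerm.symm w), fun w => ?_⟩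
    rw [reflect_eq_sum_tileValue, Int.cast_sum]
    refine Finset.sum_congr rfl fun i _ => ?_
    rw [tileValue, extendZero_intCast, Int.cast_mul]
    rcases T.sign_eq_one_or i with hs | hs <;> rw [hs] <;> norm_num

/-- Both classes are tested by integrality, which adding `X` does not affect. Only integrality of
`X` matters here, so sums and differences of corrections need not be checked to be corrections. -/
lemma eq_zero_iff_of_corrected {H : P₁.domain → ℚ} {X : Fin T.n → P₂.domain → ℤ}
    {c : SandpileGroup P₁.domain} {d : SandpileGroup P₂.domain} (hH : HarmonicRepresents H c)
    (hd : HarmonicRepresents (T.corrected H X) d) : d = 0 ↔ c = 0 := by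
  rw [hd.eq_zero_iff, hH.eq_zero_iff, ← T.exists_reflect_eq_intCast_iff, corrected_eq]
  constructor
  · rintro ⟨Y, hY⟩
    refine ⟨Y - ∑ i, X i, fun v => ?_⟩
    have := hY v
    rw [Pi.add_apply] at this
    rw [Pi.sub_apply, Int.cast_sub, ← this, add_sub_cancel_right]
  · rintro ⟨Y, hY⟩
    refine ⟨Y + ∑ i, X i, fun v => ?_⟩
    rw [Pi.add_apply, hY, Pi.add_apply, Int.cast_add]

lemma reflect_add (H H' : P₁.domain → ℚ) : T.reflect (H + H') = T.reflect H + T.reflect H' := by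
  funext w
  rw [Pi.add_apply, reflect_eq_sum_tileValue, reflect_eq_sum_tileValue, reflect_eq_sum_tileValue,
    ← Finset.sum_add_distrib]
  refine Finset.sum_congr rfl fun i _ => ?_
  rw [tileValue, tileValue, tileValue, ← mul_add]
  congr 1
  by_cases h : (T.isTilingAut i).latticePerm.symm w ∈ P₁.domain <;> simp [extendZero, h]

lemma reflect_neg (H : P₁.domain → ℚ) : T.reflect (-H) = -T.reflect H := by
  have h := T.reflect_add H (-H)
  have h0 := T.reflect_add 0 0
  rw [add_zero, left_eq_add] at h0
  rw [add_neg_cancel, h0] at h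
  exact (neg_eq_of_add_eq_zero_right h.symm).symm

lemma corrected_add (H H' : P₁.domain → ℚ) (X X' : Fin T.n → P₂.domain → ℤ) :
    T.corrected (H + H') (X + X') = T.corrected H X + T.corrected H' X' := by
  funext v
  simp only [corrected, reflect_add, Pi.add_apply, Int.cast_add, Finset.sum_add_distrib]
  ring

lemma corrected_neg (H : P₁.domain → ℚ) (X : Fin T.n → P₂.domain → ℤ) :
    T.corrected (-H) (-X) = -T.corrected H X := by
  funext v
  simp only [corrected, reflect_neg, Pi.neg_apply, Int.cast_neg, Finset.sum_neg_distrib]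
  ring

end DCTiling

theorem theorem1 (P₁ P₂ : Polyform) (hP₁ : P₁.IsConvex) (hP₂ : P₂.IsConvex)
    (D : DCStructure P₁) (T : DCTiling D P₂) :
    ∃ μ : SandpileGroup P₁.domain →+ SandpileGroup P₂.domain,
      Function.Injective μ ∧
      ∀ c : SandpileGroup P₁.domain,
        (∃ H : P₁.domain → ℚ, HarmonicRepresents H c) ∧
        ∀ H : P₁.domain → ℚ, HarmonicRepresents H c →
          (∃ X : Fin T.n → P₂.domain → ℤ, T.IsCorrection H X) ∧
          ∀ X : Fin T.n → P₂.domain → ℤ, T.IsCorrection H X →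
            HarmonicRepresents (T.corrected H X) (μ c) := by
  choose H hH using fun c : SandpileGroup P₁.domain => exists_harmonicRepresents c
  choose X hX using fun c => T.exists_isCorrection hP₁ (hH c)
  choose d hd using fun c => T.exists_harmonicRepresents_corrected hP₁ (hH c) (hX c)
  -- Independence of the choices: the difference of two corrected functions for `c` comes from a
  -- representative of `c - c = 0`, so its class is trivial.
  have hdiff : ∀ c H' X' d', HarmonicRepresents H' c →
      HarmonicRepresents (T.corrected H' X') d' → d' = d c := by
    intro c H' X' d' hH' hd'
    have h1 := hH'.add (hH c).neg
    have h2 := hd'.add (hd c).neg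
    rw [← T.corrected_neg, ← T.corrected_add] at h2
    have h3 := (T.eq_zero_iff_of_corrected h1 h2).2 (add_neg_cancel c)
    rwa [add_neg_eq_zero] at h3
  have hadd : ∀ a b, d (a + b) = d a + d b := by
    intro a b
    have h2 := (hd a).add (hd b)
    rw [← T.corrected_add] at h2
    exact (hdiff _ _ _ _ ((hH a).add (hH b)) h2).symm
  refine ⟨AddMonoidHom.mk' d hadd, ?_, fun c => ⟨⟨H c, hH c⟩, fun H' hH' =>
    ⟨T.exists_isCorrection hP₁ hH', fun X' hX' => ?_⟩⟩⟩
  · rw [injective_iff_map_eq_zero]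
    intro c hc
    exact (T.eq_zero_iff_of_corrected (hH c) (hd c)).1 hc
  · obtain ⟨d', hd'⟩ := T.exists_harmonicRepresents_corrected hP₁ hH' hX'
    have := hdiff _ _ _ _ hH' hd'
    rw [AddMonoidHom.mk'_apply, ← this]
    exact hd'
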